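/- For $n\ge 0$ put $k=\lfloor n/2\rfloor$. Monomials $\mu=z_0^{a_0}\cdots z_n^{a_n}$ of a fixed degree are partially ordered by $\mu\le\nu=z_0^{b_0}\cdots z_n^{b_n}$ iff $\sum_{i=j}^n a_i\le\sum_{i=j}^n b_i$ for all $1\le j\le n$; those of degree $m$ form a poset isomorphic to Young's lattice $L(m,n)$ of sequences $0\le\lambda_1\le\dots\le\lambda_m\le n$ (componentwise order, rank $\lambda_1+\dots+\lambda_m$) via $\lambda\mapsto z_{\lambda_1}\cdots z_{\lambda_m}$. The weight of $\mu$ is $\sum_i a_i(n-2i)$, i.e. $mn-2\,\mathrm{rk}$ on degree $m$. For $0\le r\le k$ let $G_{n,r}$ be the set of monomials $z_{i_0}\cdots z_{i_r}$ with $i_j+1<i_{j+1}$ for $0\le j\le r-1$. Consider all ways of writing $\mu$ as a product of $e_0+\dots+e_k$ monomials, $e_r$ of them from $G_{n,r}$ for each $r$; let $(\deg_k(\mu),\dots,\deg_0(\mu))$ be the lexicographically largest $(e_k,\dots,e_0)$ that occurs. For integers $d_0,\dots,d_k\ge 0$ let $$Q_n(d_0,\dots,d_k)=\{\mu \mid \deg_r(\mu)=d_r\text{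 for }0\le r\le k\}.$$ A set $S$ of monomials (or of elements of $L(m,n)$) has a symmetric chain decomposition if it is a disjoint union of chains $x_0\lessdot x_1\lessdot\dots\lessdot x_l$ that are saturated in the poset of all monomials (resp. in $L(m,n)$) and satisfy $\mathrm{wt}(x_0)+\mathrm{wt}(x_l)=0$. (1) Let $n\ge 2$ and $d_0,\dots,d_k\ge 0$. If $Q_{n-2}(d_1,\dots,d_k)$ has a symmetric chain decomposition and $$1+2d_0\ \ge\ \sum_{j=1}^k d_j(n-2j)j,$$ then $Q_n(d_0,\dots,d_k)$ has a symmetric chain decomposition. (2) Let $m,n\ge 0$. Let $L(m,n)^{gen}$ be the set of those $\lambda\in L(m,n)$ whose monomial lies in some $Q_n(d_0,\dots,d_k)$ satisfying the hypotheses of (1) (for $n\le 1$ there is no condition). Then $L(m,n)^{gen}$ has a symmetric chain decomposition. (3) Let $m,n\ge 0$. The set of those $\lambda\in L(m,n)$ whose monomial lies in some $Q_n(d_0,\dots,d_k)$ with $$1+2d_i\ \ge\ \sum_{j=i+1}^{k} d_j(n-2j)(j-i)\qquad\text{for all } 0\le i\le k$$ has a symmetric chain decomposition. -/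

import Mathlib

open scoped BigOperators

/-- A monomial `z_0^{a_0} ⋯ z_n^{a_n}` of the polynomial ring `A_n = ℂ[z_0, …, z_n]`, given by its
exponent vector. -/
@[ext]
structure Mono (n : ℕ) where
  exp : Fin (n + 1) →₀ ℕ

namespace Mono

variable {n : ℕ}

/-- The degree `a_0 + ⋯ + a_n`. -/
def degree (μ : Mono n) : ℕ := ∑ i : Fin (n + 1), μ.exp i

/-- The partial sum `a_j + a_{j+1} + ⋯ + a_n` (it is zero for `j > n`). -/
def tail (μ : Mono n) (j : ℕ) : ℕ := ∑ i ∈ Finset.univ.filter (fun i : Fin (n + 1) => j ≤ (i : ℕ)), μ.exp i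

theorem tail_eq_add (μ : Mono n) (i : Fin (n + 1)) :
    μ.tail (i : ℕ) = μ.exp i + μ.tail ((i : ℕ) + 1) := by
  have h : (Finset.univ.filter fun k : Fin (n + 1) => (i : ℕ) ≤ (k : ℕ)) =
      insert i (Finset.univ.filter fun k : Fin (n + 1) => (i : ℕ) + 1 ≤ (k : ℕ)) := by
    ext k
    simp only [Finset.mem_filter, Finset.mem_univ, true_and, Finset.mem_insert, Fin.ext_iff]
    omega
  unfold tail
  rw [h, Finset.sum_insert (by simp)]

/-- The poset of all monomials is the disjoint union of the posets `A_n(m)` of monomials of degree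
`m`: monomials of different degrees are incomparable, and for monomials of equal degree
`μ ≤ ν` means `a_j + ⋯ + a_n ≤ b_j + ⋯ + b_n` for all `j`. -/
instance : PartialOrder (Mono n) where
  le μ ν := μ.degree = ν.degree ∧ ∀ j : ℕ, μ.tail j ≤ ν.tail j
  le_refl μ := ⟨rfl, fun _ => le_rfl⟩
  le_trans _ _ _ h₁ h₂ := ⟨h₁.1.trans h₂.1, fun j => (h₁.2 j).trans (h₂.2 j)⟩
  le_antisymm μ ν h₁ h₂ := by
    have h : ∀ j, μ.tail j = ν.tail j := fun j => le_antisymm (h₁.2 j) (h₂.2 j)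
    ext i
    have e₁ := μ.tail_eq_add i
    have e₂ := ν.tail_eq_add i
    have e₃ := h (i : ℕ)
    have e₄ := h ((i : ℕ) + 1)
    omega

/-- The weight `∑ a_i (n - 2 i)`. On monomials of degree `m` it equals `m n - 2 rk`, where
`rk = ∑ i a_i` is the rank. -/
def weight (μ : Mono n) : ℤ := ∑ i : Fin (n + 1), (μ.exp i : ℤ) * ((n : ℤ) - 2 * (i : ℤ))

end Mono

/-- The exponent vectors of the minimal generators `z_{i_0} z_{i_1} ⋯ z_{i_r}`, where
`i_j + 1 < i_{j+1}` for `0 ≤ j ≤ r - 1`, of the monomial ideal `I_{n,r}`. -/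
def secantGenerators (n r : ℕ) : Set (Fin (n + 1) →₀ ℕ) :=
  {g | ∃ i : Fin (r + 1) → Fin (n + 1),
    (∀ j : Fin r, (i j.castSucc : ℕ) + 1 < (i j.succ : ℕ)) ∧
    g = ∑ j : Fin (r + 1), Finsupp.single (i j) 1}

/-- `μ` is a product of `d_0 + ⋯ + d_k` monomials, `k = ⌊n/2⌋`, of which `d_r` are minimal generators
of `I_{n,r}`, for each `0 ≤ r ≤ k`. (The values `d r` and `g r` with `r > k` do not matter.) -/
def HasFactorization (n : ℕ) (μ : Mono n) (d : ℕ → ℕ) : Prop :=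
  ∃ g : (r : ℕ) → Fin (d r) → (Fin (n + 1) →₀ ℕ),
    (∀ r ≤ n / 2, ∀ t, g r t ∈ secantGenerators n r) ∧
    μ.exp = ∑ r ∈ Finset.range (n / 2 + 1), ∑ t, g r t

/-- `deg_r(μ) = d_r` for all `0 ≤ r ≤ k`, where `k = ⌊n/2⌋`: the monomial `μ` has a maximal
factorization with `d_r` factors that are minimal generators of `I_{n,r}`. Maximal means that, going
down from `r = k` to `r = 0`, the number `d_r` is the greatest one possible in a factorization of
`μ` with the numbers `d_k, …, d_{r+1}` already fixed. -/
def HasDegrees (n : ℕ) (μ : Mono n) (d : ℕ → ℕ) : Prop :=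
  HasFactorization n μ d ∧
    ∀ e : ℕ → ℕ, HasFactorization n μ e →
      ∀ r ≤ n / 2, (∀ s, r < s → s ≤ n / 2 → e s = d s) → e r ≤ d r

/-- `Q_n(d_0, …, d_k)`, with `k = ⌊n/2⌋`: the set of monomials `μ` with `deg_r(μ) = d_r` for
`0 ≤ r ≤ k`. The values `d r` with `r > k` are not used. -/
def Q (n : ℕ) (d : ℕ → ℕ) : Set (Mono n) := {μ | HasDegrees n μ d}

/-- `C` is a saturated chain `x_0 ⋖ x_1 ⋖ ⋯ ⋖ x_l` of the ambient poset which is rank-symmetric,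
that is, the weights of its two ends are opposite. -/
def IsSymmetricSaturatedChain {α : Type*} [PartialOrder α] (wt : α → ℤ) (C : Set α) : Prop :=
  ∃ (l : ℕ) (x : Fin (l + 1) → α),
    (∀ i : Fin l, x i.castSucc ⋖ x i.succ) ∧ C = Set.range x ∧
    wt (x 0) + wt (x (Fin.last l)) = 0

/-- The subposet `S` has a symmetric chain decomposition: it is a disjoint union of rank-symmetric
saturated chains. -/
def HasSymmetricChainDecomposition {α : Type*} [PartialOrder α] (wt : α → ℤ) (S : Set α) : Prop :=
  ∃ 𝒞 : Set (Set α), (∀ C ∈ 𝒞, IsSymmetricSaturatedChain wt C) ∧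
    𝒞.PairwiseDisjoint id ∧ ⋃₀ 𝒞 = S

/-- Young's lattice `L(m,n)` of sequences `0 ≤ λ_1 ≤ ⋯ ≤ λ_m ≤ n`, ordered componentwise. -/
abbrev YoungL (m n : ℕ) : Type := Fin m →o Fin (n + 1)

namespace YoungL

variable {m n : ℕ}

/-- The monomial `z_{λ_1} z_{λ_2} ⋯ z_{λ_m}`. -/
noncomputable def toMono (p : YoungL m n) : Mono n := ⟨∑ j : Fin m, Finsupp.single (p j) 1⟩

/-- The weight `m n - 2 (λ_1 + ⋯ + λ_m)`; the rank of `λ` in `L(m,n)` is `λ_1 + ⋯ + λ_m`. -/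
def weight (p : YoungL m n) : ℤ := (m : ℤ) * n - 2 * ∑ j : Fin m, ((p j : ℕ) : ℤ)

end YoungL

/-- The inequality `1 + 2 d_0 ≥ ∑_{j=1}^k d_j (n - 2 j) j`, where `k = ⌊n/2⌋`. -/
def GenericInequality (n : ℕ) (d : ℕ → ℕ) : Prop :=
  (1 + 2 * d 0 : ℤ) ≥ ∑ j ∈ Finset.Icc 1 (n / 2), (d j : ℤ) * ((n : ℤ) - 2 * j) * j

/-- The generic part of `L(m,n)`: the union of the (images in `L(m,n)` of the) `Q_n(d_0, …, d_k)`
for which `d_0` satisfies the inequality and `Q_{n-2}(d_1, …, d_k)` has a symmetric chain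
decomposition; the latter condition is void for `n ≤ 1`, where `k = 0`. -/
def genericPart (m n : ℕ) : Set (YoungL m n) :=
  {p | ∃ d : ℕ → ℕ,
    (2 ≤ n → HasSymmetricChainDecomposition Mono.weight (Q (n - 2) fun j => d (j + 1))) ∧
    GenericInequality n d ∧ p.toMono ∈ Q n d}

/-- The part of `L(m,n)` made of the `Q_n(d_0, …, d_k)` for which the inequality holds for every
`Q_{n-2i}(d_i, …, d_k)` with `0 ≤ i ≤ k`. -/
def hereditarilyGenericPart (m n : ℕ) : Set (YoungL m n) :=
  {p | ∃ d : ℕ → ℕ,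
    (∀ i ≤ n / 2, GenericInequality (n - 2 * i) fun j => d (j + i)) ∧ p.toMono ∈ Q n d}

/-! The proof is an induction on `n` in steps of two. A factorization of a monomial with exponents
`a_0, …, a_n` is a family of sets without consecutive elements in which each index `i` occurs `a_i`
times. Let `J` be the largest sum of two consecutive exponents of `a`, and delete a pair `a_i,
a_{i+1}` with that sum. Every set of a family for the remaining monomial `b` can be enlarged by `i`
or by `i + 1`, and maximality is preserved; hence `d_0 + ⋯ + d_k = J` and the degrees of `b` are
`d_1, …, d_k` (`IsMaxPair.hasDegrees_iff`).

Conversely, `a` arises from `b` by inserting a pair `(x, y)` of sum `J`. For fixed `b` the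
insertions form a saturated chain: factors move one at a time from `x` to `y`, and once `x` has
dropped to `b_i` the same monomial is an insertion one place further right. With `N = (n + 2) J - 2
deg b`, this chain has `N + 1` elements and its weights are symmetric about that of `b`.

If `d_0 > 0`, no pair of `b` has sum `J`, so distinct `b` give disjoint chains, and a symmetric
chain with `l` steps in the smaller set yields a grid of `(l + 1)(N + 1)` monomials. Steps along an
insertion chain are always covers. Steps from `b` to `b'` at a fixed position `t` are known to be
covers when the pair can be put at the far left or far right, that is, for `t ≤ d_0` or `t ≥ N -
d_0`. Nested hooks decompose the grid and need only these rows if `l ≤ 2 d_0 + 1`. Now `l` is the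
weight of the bottom of the chain, and weights are bounded through the generators, of which `z_0 z_2
⋯ z_{2r}` is the heaviest; the inequality of the theorem is exactly what this requires. If `d_0 =
0`, the inequality leaves only sets with at most three elements.

For the lattice statements, monomials of degree `m` are identified with `L(m,n)`, and distinct sets
`Q` are disjoint because the degrees are unique. -/

namespace Mono

/-! ### Prefix sums, and the grading of the poset by weight -/

variable {n : ℕ}

/-- The exponent of `z_i`, extended by zero to all `i : ℕ`. -/
def coeff (μ : Mono n) (i : ℕ) : ℕ := if h : i < n + 1 then μ.exp ⟨i, h⟩ else 0

/-- The monomial with exponents `a 0, …, a n`. -/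
noncomputable def ofCoeff (n : ℕ) (a : ℕ → ℕ) : Mono n :=
  ⟨Finsupp.equivFunOnFinite.symm fun i => a i⟩

theorem coeff_fin (μ : Mono n) (i : Fin (n + 1)) : μ.coeff i = μ.exp i := by
  rw [coeff, dif_pos i.isLt]

theorem coeff_of_lt (μ : Mono n) {i : ℕ} (h : n < i) : μ.coeff i = 0 := by
  rw [coeff, dif_neg (by omega)]

theorem coeff_ofCoeff {a : ℕ → ℕ} (h : ∀ i, n < i → a i = 0) : (ofCoeff n a).coeff = a := by
  ext i
  by_cases hi : i < n + 1
  · simp [coeff, ofCoeff, hi]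
  · rw [coeff, dif_neg hi, h i (by omega)]

theorem coeff_injective : Function.Injective (coeff : Mono n → ℕ → ℕ) := by
  intro μ ν h
  ext i
  rw [← coeff_fin, ← coeff_fin, h]

/-- The partial sum `a_0 + ⋯ + a_{j-1}`. -/
def prefixSum (μ : Mono n) (j : ℕ) : ℕ := ∑ i ∈ Finset.range j, μ.coeff i

theorem degree_eq_sum_range (μ : Mono n) : μ.degree = ∑ i ∈ Finset.range (n + 1), μ.coeff i := by
  rw [Finset.sum_range]
  exact Finset.sum_congr rfl fun i _ => (μ.coeff_fin i).symm

theorem prefixSum_succ (μ : Mono n) (j : ℕ) : μ.prefixSum (j + 1) = μ.prefixSum j + μ.coeff j :=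
  Finset.sum_range_succ _ _

theorem prefixSum_zero (μ : Mono n) : μ.prefixSum 0 = 0 := rfl

theorem prefixSum_mono (μ : Mono n) : Monotone μ.prefixSum :=
  monotone_nat_of_le_succ fun j => by rw [prefixSum_succ]; omega

theorem prefixSum_of_lt (μ : Mono n) {j : ℕ} (h : n < j) : μ.prefixSum j = μ.degree := by
  rw [degree_eq_sum_range]
  refine (Finset.sum_subset (by simp; omega) fun i _ hi => μ.coeff_of_lt ?_).symm
  simpa using hi

theorem prefixSum_le_degree (μ : Mono n) (j : ℕ) : μ.prefixSum j ≤ μ.degree := by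
  rw [← μ.prefixSum_of_lt (j := n + 1 + j) (by omega)]
  exact μ.prefixSum_mono (by omega)

theorem tail_add_prefixSum (μ : Mono n) (j : ℕ) : μ.tail j + μ.prefixSum j = μ.degree := by
  have h0 : ∀ j, n < j → μ.tail j = 0 := by
    intro j hj
    refine Finset.sum_eq_zero fun i hi => ?_
    have := (Finset.mem_filter.1 hi).2
    omega
  by_cases hj : n < j
  · rw [h0 j hj, prefixSum_of_lt _ hj, zero_add]
  · have key : ∀ k j, j + k = n + 1 → μ.tail j + μ.prefixSum j = μ.degree := by
      intro k
      induction k with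
      | zero => intro j hj; rw [h0 j (by omega), prefixSum_of_lt _ (by omega), zero_add]
      | succ k ih =>
        intro j hj
        have h1 := ih (j + 1) (by omega)
        have h2 := μ.tail_eq_add ⟨j, by omega⟩
        have h3 := μ.coeff_fin ⟨j, by omega⟩
        simp only at h2 h3
        rw [prefixSum_succ, h3] at h1
        omega
    exact key (n + 1 - j) j (by omega)

theorem le_iff_prefixSum {μ ν : Mono n} :
    μ ≤ ν ↔ μ.degree = ν.degree ∧ ∀ j, ν.prefixSum j ≤ μ.prefixSum j := by
  constructor
  · rintro ⟨h, h'⟩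
    refine ⟨h, fun j => ?_⟩
    have := h' j
    have := μ.tail_add_prefixSum j
    have := ν.tail_add_prefixSum j
    omega
  · rintro ⟨h, h'⟩
    refine ⟨h, fun j => ?_⟩
    have := h' j
    have := μ.tail_add_prefixSum j
    have := ν.tail_add_prefixSum j
    omega

theorem prefixSum_injective : Function.Injective (prefixSum : Mono n → ℕ → ℕ) := by
  intro μ ν h
  apply coeff_injective
  ext j
  have h1 := μ.prefixSum_succ j
  have h2 := ν.prefixSum_succ j
  rw [h] at h1
  omega

theorem weight_eq_sum_range (μ : Mono n) :
    μ.weight = ∑ i ∈ Finset.range (n + 1), (μ.coeff i : ℤ) * ((n : ℤ) - 2 * i) := by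
  rw [Finset.sum_range]
  exact Finset.sum_congr rfl fun i _ => by rw [coeff_fin]

theorem sum_sum_range (a : ℕ → ℤ) (N : ℕ) :
    ∑ j ∈ Finset.range (N + 1), ∑ i ∈ Finset.range j, a i =
      ∑ i ∈ Finset.range (N + 1), a i * ((N : ℤ) - i) := by
  induction N with
  | zero => simp
  | succ N ih =>
    rw [Finset.sum_range_succ, ih, Finset.sum_range_succ _ (N + 1), ← Finset.sum_add_distrib]
    push_cast
    rw [sub_self, mul_zero, add_zero]
    exact Finset.sum_congr rfl fun i _ => by ring

theorem weight_eq_prefixSum (μ : Mono n) :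
    μ.weight = 2 * ∑ j ∈ Finset.range (n + 1), (μ.prefixSum j : ℤ) - n * μ.degree := by
  have h := sum_sum_range (fun i => (μ.coeff i : ℤ)) n
  have h' : ∑ j ∈ Finset.range (n + 1), (μ.prefixSum j : ℤ) =
      ∑ j ∈ Finset.range (n + 1), ∑ i ∈ Finset.range j, (μ.coeff i : ℤ) :=
    Finset.sum_congr rfl fun j _ => by simp [prefixSum]
  rw [h', h, weight_eq_sum_range, degree_eq_sum_range, Nat.cast_sum, Finset.mul_sum, Finset.mul_sum,
    ← Finset.sum_sub_distrib]
  exact Finset.sum_congr rfl fun i _ => by ring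

theorem weight_add_two_le_of_lt {μ ν : Mono n} (h : μ < ν) : ν.weight + 2 ≤ μ.weight := by
  obtain ⟨hd, hp⟩ := le_iff_prefixSum.1 h.le
  have hs : ∑ j ∈ Finset.range (n + 1), (ν.prefixSum j : ℤ) <
      ∑ j ∈ Finset.range (n + 1), (μ.prefixSum j : ℤ) := by
    refine Finset.sum_lt_sum (fun j _ => by exact_mod_cast hp j) ?_
    by_contra! hc
    refine h.ne (prefixSum_injective (funext fun j => ?_))
    by_cases hj : j < n + 1
    · have h1 := hc j (Finset.mem_range.2 hj)
      have h2 := hp j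
      omega
    · rw [prefixSum_of_lt _ (by omega), prefixSum_of_lt _ (by omega), hd]
  rw [weight_eq_prefixSum, weight_eq_prefixSum, hd]
  linarith

theorem covBy_of_le_of_weight {μ ν : Mono n} (h : μ ≤ ν) (hw : μ.weight = ν.weight + 2) :
    μ ⋖ ν := by
  refine ⟨lt_of_le_of_ne h fun h' => by rw [h'] at hw; omega, fun ρ h1 h2 => ?_⟩
  have := weight_add_two_le_of_lt h1
  have := weight_add_two_le_of_lt h2
  omega

/-- Moving one factor `z_i` of a monomial to `z_{i+1}`. -/
theorem exists_prefixSum_sub_one (μ : Mono n) {j : ℕ} (hj : j < n)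
    (h : 0 < μ.coeff j) :
    ∃ ρ : Mono n, ρ.degree = μ.degree ∧
      ∀ i, ρ.prefixSum i = if i = j + 1 then μ.prefixSum i - 1 else μ.prefixSum i := by
  let a : ℕ → ℕ := fun i =>
    if i = j then μ.coeff i - 1 else if i = j + 1 then μ.coeff i + 1 else μ.coeff i
  have ha : ∀ i, n < i → a i = 0 := by
    intro i hi
    simp only [a, μ.coeff_of_lt hi]
    split_ifs <;> omega
  have hp : ∀ i, (ofCoeff n a).prefixSum i =
      if i = j + 1 then μ.prefixSum i - 1 else μ.prefixSum i := by
    intro i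
    induction i with
    | zero => simp [prefixSum_zero]
    | succ i ih =>
      rw [prefixSum_succ, ih, coeff_ofCoeff ha, prefixSum_succ]
      simp only [a]
      by_cases h1 : i = j
      · subst h1; simp; omega
      · by_cases h2 : i = j + 1
        · subst h2; simp [prefixSum_succ]; omega
        · simp [h1, h2]
  refine ⟨ofCoeff n a, ?_, hp⟩
  rw [← prefixSum_of_lt _ (Nat.lt_succ_self n), ← prefixSum_of_lt μ (Nat.lt_succ_self n), hp,
    if_neg (by omega)]

/-- Let `j + 1` be the first index at which the prefix sums differ. Then `μ` contains `z_j`, and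
moving one such factor to `z_{j+1}` gives a monomial strictly above `μ` and still at most `ν`, hence
`ν` itself. -/
theorem weight_of_covBy {μ ν : Mono n} (h : μ ⋖ ν) : μ.weight = ν.weight + 2 := by
  obtain ⟨hd, hp⟩ := le_iff_prefixSum.1 h.le
  have hne : ∃ j, ν.prefixSum j < μ.prefixSum j := by
    by_contra! hc
    exact h.ne (prefixSum_injective (funext fun j => le_antisymm (hc j) (hp j)))
  classical
  obtain ⟨j, hj⟩ : ∃ j, Nat.find hne = j + 1 := Nat.exists_eq_succ_of_ne_zero fun h0 => by
    have := Nat.find_spec hne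
    rw [h0] at this
    simp [prefixSum_zero] at this
  have h1 := Nat.find_spec hne
  have h2 := Nat.find_min hne (m := j) (by omega)
  rw [hj] at h1
  have h3 := hp j
  have h4 := ν.prefixSum_mono (Nat.le_succ j)
  have h5 := μ.prefixSum_succ j
  have hjn : j < n := by
    by_contra hc
    rw [prefixSum_of_lt _ (by omega), prefixSum_of_lt _ (by omega), hd] at h1
    omega
  simp only [Nat.succ_eq_add_one] at h4
  obtain ⟨ρ, hρd, hρ⟩ := μ.exists_prefixSum_sub_one hjn (by omega)
  have hμρ : μ ≤ ρ := le_iff_prefixSum.2 ⟨hρd.symm, fun i => by rw [hρ]; split_ifs <;> omega⟩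
  have hρν : ρ ≤ ν := le_iff_prefixSum.2 ⟨hρd.trans hd, fun i => by
    rw [hρ]
    split_ifs with hi
    · subst hi; omega
    · exact hp i⟩
  have hne' : μ ≠ ρ := by
    intro he
    have := hρ (j + 1)
    rw [← he, if_pos rfl] at this
    omega
  have hρ' : ρ = ν := by
    by_contra hc
    exact h.2 (lt_of_le_of_ne hμρ hne') (lt_of_le_of_ne hρν hc)
  subst hρ'
  have hs : ∑ i ∈ Finset.range (n + 1), (ρ.prefixSum i : ℤ) =
      ∑ i ∈ Finset.range (n + 1), ((μ.prefixSum i : ℤ) - if i = j + 1 then 1 else 0) := by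
    refine Finset.sum_congr rfl fun i _ => ?_
    rw [hρ]
    split_ifs with hi
    · subst hi; omega
    · simp
  rw [Finset.sum_sub_distrib, Finset.sum_ite_eq' , if_pos (Finset.mem_range.2 (by omega))] at hs
  rw [weight_eq_prefixSum, weight_eq_prefixSum, hs, hd]
  ring

end Mono

/-! ### Factorizations as families of sparse sets -/

/-- `S ⊆ {0, …, n}` has no two consecutive elements. -/
def IsSparse (n : ℕ) (S : Finset ℕ) : Prop := (∀ i ∈ S, i ≤ n) ∧ ∀ i ∈ S, i + 1 ∉ S

/-- `S` is a family of sparse sets such that each `j` belongs to `a j` of them. -/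
def IsSparseCover (n : ℕ) (a : ℕ → ℕ) {ι : Type*} [Fintype ι] (S : ι → Finset ℕ) : Prop :=
  (∀ p, IsSparse n (S p)) ∧ ∀ j, (Finset.univ.filter fun p => j ∈ S p).card = a j

theorem IsSparse.card_le {n : ℕ} {S : Finset ℕ} (h : IsSparse n S) : S.card ≤ n / 2 + 1 := by
  have hd : Disjoint S (S.image (· + 1)) := by
    rw [Finset.disjoint_left]
    intro x hx hx'
    obtain ⟨y, hy, rfl⟩ := Finset.mem_image.1 hx'
    exact h.2 y hy hx
  have hsub : S ∪ S.image (· + 1) ⊆ Finset.range (n + 2) := by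
    intro x hx
    rcases Finset.mem_union.1 hx with hx | hx
    · have := h.1 x hx
      simp; omega
    · obtain ⟨y, hy, rfl⟩ := Finset.mem_image.1 hx
      have := h.1 y hy
      simp; omega
  have := Finset.card_le_card hsub
  rw [Finset.card_union_of_disjoint hd, Finset.card_image_of_injective _ (add_left_injective 1),
    Finset.card_range] at this
  omega

theorem mem_secantGenerators_iff {n r : ℕ} {g : Fin (n + 1) →₀ ℕ} :
    g ∈ secantGenerators n r ↔ ∃ S, IsSparse n S ∧ S.card = r + 1 ∧
      ∀ j : Fin (n + 1), g j = if (j : ℕ) ∈ S then 1 else 0 := by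
  constructor
  · rintro ⟨i, hi, rfl⟩
    have hm : StrictMono fun j => (i j : ℕ) :=
      Fin.strictMono_iff_lt_succ.2 fun j => by have := hi j; omega
    refine ⟨Finset.univ.image fun j => (i j : ℕ), ⟨?_, ?_⟩, ?_, fun x => ?_⟩
    · intro x hx
      obtain ⟨j, -, rfl⟩ := Finset.mem_image.1 hx
      have := (i j).isLt
      omega
    · intro x hx hx'
      obtain ⟨j, -, rfl⟩ := Finset.mem_image.1 hx
      obtain ⟨j', -, hj'⟩ := Finset.mem_image.1 hx'
      have hlt : j < j' := hm.lt_iff_lt.1 (by omega)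
      obtain ⟨j, rfl⟩ := Fin.eq_castSucc_of_ne_last (Fin.ne_last_of_lt hlt)
      have h1 := hi j
      have h2 := hm.monotone (Fin.castSucc_lt_iff_succ_le.1 hlt)
      omega
    · rw [Finset.card_image_of_injective _ hm.injective, Finset.card_univ, Fintype.card_fin]
    · rw [Finsupp.finsetSum_apply]
      split_ifs with h
      · obtain ⟨j, -, hj⟩ := Finset.mem_image.1 h
        have hj : i j = x := Fin.ext hj
        subst hj
        rw [Finset.sum_eq_single j]
        · simp
        · intro j' _ hne
          exact Finsupp.single_eq_of_ne fun h => hne (hm.injective (congrArg Fin.val h.symm))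
        · simp
      · refine Finset.sum_eq_zero fun j _ => Finsupp.single_eq_of_ne fun hj => h ?_
        exact Finset.mem_image.2 ⟨j, Finset.mem_univ _, by rw [hj]⟩
  · rintro ⟨S, hS, hc, hg⟩
    let f := S.orderEmbOfFin hc
    have hf : ∀ j, f j ∈ S := S.orderEmbOfFin_mem hc
    refine ⟨fun j => ⟨f j, Nat.lt_succ_of_le (hS.1 _ (hf j))⟩, fun j => ?_, ?_⟩
    · have h1 : f j.castSucc < f j.succ := f.strictMono Fin.castSucc_lt_succ
      have h2 : f j.castSucc + 1 ≠ f j.succ := fun h => hS.2 _ (hf j.castSucc) (h ▸ hf j.succ)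
      simp only
      omega
    · ext x
      rw [hg, Finsupp.finsetSum_apply]
      symm
      split_ifs with h
      · obtain ⟨j, hj⟩ : (x : ℕ) ∈ Set.range f := by rw [S.range_orderEmbOfFin hc]; exact h
        rw [Finset.sum_eq_single j]
        · simp [hj]
        · intro j' _ hne
          refine Finsupp.single_eq_of_ne fun h => hne (f.injective ?_)
          rw [hj, h]
        · simp
      · refine Finset.sum_eq_zero fun j _ => Finsupp.single_eq_of_ne fun hj => h ?_
        rw [hj]
        exact hf j

theorem HasFactorization.exists_cover {n : ℕ} {μ : Mono n} {e : ℕ → ℕ}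
    (h : HasFactorization n μ e) :
    ∃ S : ((r : Fin (n / 2 + 1)) × Fin (e r)) → Finset ℕ,
      IsSparseCover n μ.coeff S ∧ ∀ p, (S p).card = p.1 + 1 := by
  obtain ⟨g, hg, hμ⟩ := h
  choose S hS hc hgS using fun p : (r : Fin (n / 2 + 1)) × Fin (e r) =>
    mem_secantGenerators_iff.1 (hg p.1 (Nat.le_of_lt_succ p.1.isLt) p.2)
  refine ⟨S, ⟨hS, fun j => ?_⟩, hc⟩
  by_cases hj : j < n + 1
  · rw [show j = ((⟨j, hj⟩ : Fin (n + 1)) : ℕ) from rfl, Mono.coeff_fin, hμ, Finset.sum_range,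
      Finset.card_filter, Fintype.sum_sigma, Finsupp.finsetSum_apply]
    refine Finset.sum_congr rfl fun r _ => ?_
    rw [Finsupp.finsetSum_apply]
    exact Finset.sum_congr rfl fun t _ => (hgS ⟨r, t⟩ _).symm
  · rw [μ.coeff_of_lt (by omega), Finset.card_eq_zero, Finset.filter_eq_empty_iff]
    intro p _ hp
    exact hj (Nat.lt_succ_of_le ((hS p).1 _ hp))

/-- Empty sets are allowed in the family and do not count; this permits padding and removing
elements without reindexing. -/
theorem hasFactorization_of_cover {n : ℕ} {μ : Mono n} {e : ℕ → ℕ} {ι : Type*} [Fintype ι]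
    {S : ι → Finset ℕ} (hS : IsSparseCover n μ.coeff S)
    (he : ∀ r ≤ n / 2, (Finset.univ.filter fun p => (S p).card = r + 1).card = e r) :
    HasFactorization n μ e := by
  classical
  let ind : ι → (Fin (n + 1) →₀ ℕ) := fun p =>
    Finsupp.equivFunOnFinite.symm fun j => if (j : ℕ) ∈ S p then 1 else 0
  have heq : ∀ r, r ≤ n / 2 → Nonempty (Fin (e r) ≃ {p // (S p).card = r + 1}) := fun r hr =>
    ⟨(Fintype.equivFinOfCardEq ((Fintype.card_subtype _).trans (he r hr))).symm⟩
  refine ⟨fun r t => if hr : r ≤ n / 2 then ind ((heq r hr).some t) else 0, ?_, ?_⟩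
  · intro r hr t
    simp only [dif_pos hr]
    rw [mem_secantGenerators_iff]
    exact ⟨S ((heq r hr).some t), hS.1 _, ((heq r hr).some t).2, fun j => by simp [ind]⟩
  · have hsum : ∀ r ∈ Finset.range (n / 2 + 1),
        ∑ t : Fin (e r), (if hr : r ≤ n / 2 then ind ((heq r hr).some t) else 0) =
          ∑ p, if (S p).card = r + 1 then ind p else 0 := by
      intro r hr
      have hr : r ≤ n / 2 := Nat.le_of_lt_succ (Finset.mem_range.1 hr)
      simp only [dif_pos hr]
      rw [(heq r hr).some.sum_comp fun p : {p // (S p).card = r + 1} => ind p,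
        ← Finset.sum_filter]
      exact (Finset.sum_subtype _ (by simp) ind).symm
    rw [Finset.sum_congr rfl hsum, Finset.sum_comm]
    ext j
    rw [← Mono.coeff_fin, ← hS.2, Finset.card_filter, Finsupp.finsetSum_apply]
    refine Finset.sum_congr rfl fun p _ => ?_
    by_cases hj : (j : ℕ) ∈ S p
    · have h1 := (hS.1 p).card_le
      have h2 := Finset.card_pos.2 ⟨_, hj⟩
      rw [if_pos hj, Finset.sum_eq_single ((S p).card - 1), if_pos (by omega)]
      · simp [ind, hj]
      · intro r _ hr
        exact if_neg (by omega)
      · intro hr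
        simp at hr
        omega
    · rw [if_neg hj, Finsupp.finsetSum_apply]
      symm
      refine Finset.sum_eq_zero fun r _ => ?_
      split_ifs <;> simp [ind, hj]

theorem HasFactorization.degree_eq {n : ℕ} {μ : Mono n} {e : ℕ → ℕ}
    (h : HasFactorization n μ e) :
    μ.degree = ∑ r ∈ Finset.range (n / 2 + 1), (r + 1) * e r := by
  obtain ⟨S, hS, hc⟩ := h.exists_cover
  rw [Mono.degree_eq_sum_range]
  simp_rw [← hS.2, Finset.card_filter]
  rw [Finset.sum_comm]
  have : ∀ p, ∑ j ∈ Finset.range (n + 1), (if j ∈ S p then 1 else 0) = (p.1 : ℕ) + 1 := by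
    intro p
    rw [← Finset.card_filter, ← hc p]
    congr 1
    ext j
    have := (hS.1 p).1 j
    simp only [Finset.mem_filter, Finset.mem_range]
    constructor
    · exact fun h => h.2
    · exact fun h => ⟨by have := this h; omega, h⟩
  simp_rw [this]
  rw [Fintype.sum_sigma, Finset.sum_range]
  exact Finset.sum_congr rfl fun r _ => by simp [mul_comm]

/-! ### Deleting two adjacent exponents -/

/-- The increasing enumeration of `ℕ ∖ {i, i + 1}`. -/
def skipTwo (i : ℕ) : ℕ ↪ ℕ where
  toFun j := if j < i then j else j + 2
  inj' j j' h := by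
    simp only at h
    split_ifs at h <;> omega

theorem skipTwo_of_lt {i j : ℕ} (h : j < i) : skipTwo i j = j := if_pos h

theorem skipTwo_of_le {i j : ℕ} (h : i ≤ j) : skipTwo i j = j + 2 := if_neg (by omega)

theorem mem_map_skipTwo {i y : ℕ} {S : Finset ℕ} :
    y ∈ S.map (skipTwo i) ↔ (y < i ∧ y ∈ S) ∨ (i + 2 ≤ y ∧ y - 2 ∈ S) := by
  rw [Finset.mem_map]
  constructor
  · rintro ⟨x, hx, rfl⟩
    rcases lt_or_ge x i with h | h
    · rw [skipTwo_of_lt h]; exact Or.inl ⟨h, hx⟩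
    · rw [skipTwo_of_le h]; exact Or.inr ⟨by omega, by simpa using hx⟩
  · rintro (⟨h, hy⟩ | ⟨h, hy⟩)
    · exact ⟨y, hy, skipTwo_of_lt h⟩
    · exact ⟨y - 2, hy, by rw [skipTwo_of_le (by omega)]; omega⟩

/-- `b` arises from `a` by deleting the exponents with indices `i` and `i + 1`. -/
def IsDeletion {n : ℕ} (i : ℕ) (a : Mono (n + 2)) (b : Mono n) : Prop :=
  ∀ j, b.coeff j = a.coeff (skipTwo i j)

theorem IsDeletion.coeff_of_lt {n i j : ℕ} {a : Mono (n + 2)} {b : Mono n}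
    (h : IsDeletion i a b) (hj : j < i) : b.coeff j = a.coeff j := by
  rw [h, skipTwo_of_lt hj]

theorem IsDeletion.coeff_of_le {n i j : ℕ} {a : Mono (n + 2)} {b : Mono n}
    (h : IsDeletion i a b) (hj : i ≤ j) : b.coeff j = a.coeff (j + 2) := by
  rw [h, skipTwo_of_le hj]

/-- A family for `b`, padded to `a_i + a_{i+1}` members, becomes one for `a` when each member
receives `i` or `i + 1`. The two hypotheses on neighbouring exponents leave enough room for the
members whose choice is forced. -/
theorem IsDeletion.hasFactorization {n i : ℕ} {a : Mono (n + 2)} {b : Mono n}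
    (hab : IsDeletion i a b) (hi : i ≤ n + 1) (hr : a.coeff (i + 2) ≤ a.coeff i)
    (hl : ∀ j, j + 1 = i → a.coeff j ≤ a.coeff (i + 1)) {D d : ℕ → ℕ}
    (hD : HasFactorization n b D)
    (h0 : d 0 + ∑ r ∈ Finset.range (n / 2 + 1), D r = a.coeff i + a.coeff (i + 1))
    (hd : ∀ r ≤ n / 2, d (r + 1) = D r) : HasFactorization (n + 2) a d := by
  classical
  obtain ⟨S, hS, hc⟩ := hD.exists_cover
  -- The `d 0` empty sets become singletons, which are the factors of index `0` in the new
  -- factorization.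
  let κ := ((r : Fin (n / 2 + 1)) × Fin (D r)) ⊕ Fin (d 0)
  let S' : κ → Finset ℕ := Sum.elim S fun _ => ∅
  have hS' : IsSparseCover n b.coeff S' := by
    refine ⟨?_, fun j => ?_⟩
    · rintro (p | p)
      · exact hS.1 p
      · exact ⟨by simp [S'], by simp [S']⟩
    · rw [← hS.2, Finset.card_filter, Finset.card_filter, Fintype.sum_sum_type]
      simp only [S', Sum.elim_inl, Sum.elim_inr, Finset.notMem_empty, if_false,
        Finset.sum_const_zero, add_zero]
      rfl
  have hκ : Fintype.card κ = a.coeff i + a.coeff (i + 1) := by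
    rw [← h0]
    simp only [κ, Fintype.card_sum, Fintype.card_sigma, Fintype.card_fin]
    rw [Finset.sum_range, add_comm]
  -- After the shift, members of `A` contain `i + 2` and must receive `i`, while members of `B`
  -- contain `i - 1` and must receive `i + 1`. `C` will be the set of members receiving `i`.
  let A := Finset.univ.filter fun q => i ∈ S' q
  let B := Finset.univ.filter fun q => ∃ j, j + 1 = i ∧ j ∈ S' q
  have hA : A.card ≤ a.coeff i := by
    simp only [A]
    rw [hS'.2, hab.coeff_of_le le_rfl]
    exact hr
  have hB : B.card ≤ a.coeff (i + 1) := by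
    rcases i with _ | i
    · simp [B]
    · have : B = Finset.univ.filter fun q => i ∈ S' q := by
        ext q; simp [B]
      rw [this, hS'.2, hab.coeff_of_lt (Nat.lt_succ_self i)]
      exact hl i rfl
  have hAB : A ⊆ Bᶜ := by
    intro q hq
    simp only [A, B, Finset.mem_compl, Finset.mem_filter, Finset.mem_univ, true_and] at hq ⊢
    rintro ⟨j, rfl, hj⟩
    exact (hS'.1 q).2 j hj hq
  obtain ⟨C, hAC, hCB, hC⟩ := Finset.exists_subsuperset_card_eq hAB hA
    (by rw [Finset.card_compl, hκ]; omega)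
  let T : κ → Finset ℕ := fun q => insert (if q ∈ C then i else i + 1) ((S' q).map (skipTwo i))
  have hmem : ∀ q y, y ∈ T q ↔
      (y = i ∧ q ∈ C) ∨ (y = i + 1 ∧ q ∉ C) ∨ (y < i ∧ y ∈ S' q) ∨ (i + 2 ≤ y ∧ y - 2 ∈ S' q) := by
    intro q y
    simp only [T, Finset.mem_insert, mem_map_skipTwo]
    by_cases hq : q ∈ C <;> simp [hq]
  have hTc : ∀ q, (T q).card = (S' q).card + 1 := by
    intro q
    rw [Finset.card_insert_of_notMem, Finset.card_map]
    rw [mem_map_skipTwo]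
    split_ifs <;> omega
  refine hasFactorization_of_cover (S := T) ⟨fun q => ⟨fun y hy => ?_, fun y hy hy' => ?_⟩,
    fun j => ?_⟩ fun r hr => ?_
  · rcases (hmem q y).1 hy with h | h | h | h
    · omega
    · omega
    · omega
    · have := (hS'.1 q).1 _ h.2
      omega
  · have h1 : i ∈ S' q → q ∈ C := fun h => hAC (by simp [A, h])
    have h2 : ∀ j, j + 1 = i → j ∈ S' q → q ∉ C := fun j hj hjq hq => by
      have := hCB hq
      simp only [B, Finset.mem_compl, Finset.mem_filter, Finset.mem_univ, true_and] at this
      exact this ⟨j, hj, hjq⟩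
    rcases (hmem q y).1 hy with h | h | h | h <;> rcases (hmem q (y + 1)).1 hy' with h' | h' | h' | h'
    · omega
    · exact h'.2 h.2
    · omega
    · omega
    · omega
    · omega
    · omega
    · refine h.2 (h1 ?_)
      have : y + 1 - 2 = i := by omega
      exact this ▸ h'.2
    · exact h2 y h'.1 h.2 h'.2
    · omega
    · exact (hS'.1 q).2 y h.2 h'.2
    · omega
    · omega
    · omega
    · omega
    · refine (hS'.1 q).2 _ h.2 ?_
      have : y + 1 - 2 = y - 2 + 1 := by omega
      exact this ▸ h'.2
  · by_cases h1 : j = i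
    · subst h1
      rw [← hC]
      congr 1
      ext q
      simp [hmem]
    · by_cases h2 : j = i + 1
      · subst h2
        have : (Finset.univ.filter fun q => i + 1 ∈ T q) = Cᶜ := by
          ext q
          simp [hmem]
        rw [this, Finset.card_compl, hκ, hC]
        omega
      · by_cases h3 : j < i
        · rw [← hab.coeff_of_lt h3, ← hS'.2]
          congr 1
          ext q
          simp only [Finset.mem_filter, Finset.mem_univ, true_and, hmem]
          grind
        · obtain ⟨j, rfl⟩ : ∃ j', j = j' + 2 := ⟨j - 2, by omega⟩
          rw [← hab.coeff_of_le (by omega), ← hS'.2]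
          congr 1
          ext q
          simp only [Finset.mem_filter, Finset.mem_univ, true_and, hmem]
          grind
  · simp_rw [hTc]
    rw [Finset.card_filter, Fintype.sum_sum_type, Fintype.sum_sigma]
    rcases r with _ | r
    · simp [S', hc]
    · have hr' : r ≤ n / 2 := by omega
      rw [hd r hr', Finset.sum_eq_single (⟨r, by omega⟩ : Fin (n / 2 + 1))]
      · simp [S', hc]
      · intro r' _ hne
        have : (r' : ℕ) ≠ r := fun h => hne (Fin.ext h)
        simp [S', hc, this]
      · simp

/-- The number of members of a family with at least `s` elements. -/
def atLeast {ι : Type*} [Fintype ι] (S : ι → Finset ℕ) (s : ℕ) : ℕ :=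
  (Finset.univ.filter fun p => s ≤ (S p).card).card

theorem atLeast_eq_add {ι : Type*} [Fintype ι] (S : ι → Finset ℕ) (s : ℕ) :
    atLeast S s = (Finset.univ.filter fun p => (S p).card = s).card + atLeast S (s + 1) := by
  classical
  rw [atLeast, atLeast, ← Finset.card_union_of_disjoint]
  · congr 1
    ext p
    simp only [Finset.mem_union, Finset.mem_filter, Finset.mem_univ, true_and]
    omega
  · rw [Finset.disjoint_left]
    intro p
    simp only [Finset.mem_filter, Finset.mem_univ, true_and]
    omega

theorem IsSparseCover.atLeast_eq_zero {n : ℕ} {a : ℕ → ℕ} {ι : Type*} [Fintype ι]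
    {S : ι → Finset ℕ} (h : IsSparseCover n a S) {s : ℕ} (hs : n / 2 + 2 ≤ s) :
    atLeast S s = 0 := by
  rw [atLeast, Finset.card_eq_zero, Finset.filter_eq_empty_iff]
  intro p _ hp
  have := (h.1 p).card_le
  omega

theorem card_preimage_skipTwo {n : ℕ} (i : ℕ) {S : Finset ℕ} (hS : IsSparse n S) :
    S.card ≤ (S.preimage (skipTwo i) (skipTwo i).injective.injOn).card +
      if i ∈ S ∨ i + 1 ∈ S then 1 else 0 := by
  classical
  have hsub : S ⊆ (S.preimage (skipTwo i) (skipTwo i).injective.injOn).map (skipTwo i) ∪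
      S.filter fun j => j = i ∨ j = i + 1 := by
    intro j hj
    rw [Finset.mem_union, mem_map_skipTwo, Finset.mem_preimage, Finset.mem_preimage,
      Finset.mem_filter]
    rcases lt_trichotomy j i with h | h | h
    · exact Or.inl (Or.inl ⟨h, by rwa [skipTwo_of_lt h]⟩)
    · exact Or.inr ⟨hj, Or.inl h⟩
    · by_cases h' : j = i + 1
      · exact Or.inr ⟨hj, Or.inr h'⟩
      · refine Or.inl (Or.inr ⟨by omega, ?_⟩)
        rw [skipTwo_of_le (by omega)]
        convert hj using 1
        omega
  refine (Finset.card_le_card hsub).trans ((Finset.card_union_le _ _).trans ?_)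
  rw [Finset.card_map]
  refine Nat.add_le_add_left ?_ _
  split_ifs with h
  · rw [Finset.card_le_one]
    intro x hx y hy
    have hx := Finset.mem_filter.1 hx
    have hy := Finset.mem_filter.1 hy
    rcases hx.2 with h1 | h1 <;> rcases hy.2 with h2 | h2
    · omega
    · exact absurd (by rw [h1, ← h2]; exact hy.1) (hS.2 _ hx.1)
    · exact absurd (by rw [h2, ← h1]; exact hx.1) (hS.2 _ hy.1)
    · omega
  · rw [Nat.le_zero, Finset.card_eq_zero, Finset.filter_eq_empty_iff]
    rintro x hx (rfl | rfl)
    · exact h (Or.inl hx)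
    · exact h (Or.inr hx)

/-- Removing `i` and `i + 1` costs a sparse set at most one element. The gap may close so that `i -
1` and `i + 2` become adjacent; then the set contained neither `i` nor `i + 1`, and the single
element that is split off to restore sparsity is the only loss. -/
theorem IsDeletion.exists_cover {n i : ℕ} {a : Mono (n + 2)} {b : Mono n}
    (hab : IsDeletion i a b) {ι : Type*} [Fintype ι] {S : ι → Finset ℕ}
    (hS : IsSparseCover (n + 2) a.coeff S) (hi : i ≤ n + 1) :
    ∃ T : ι ⊕ ι → Finset ℕ, IsSparseCover n b.coeff T ∧
      ∀ s, atLeast S (s + 1) ≤ atLeast T s := by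
  classical
  let P : ι → Finset ℕ := fun p => (S p).preimage (skipTwo i) (skipTwo i).injective.injOn
  -- The split-off part: `{i}`, the image of `i + 2`, if the set contains both `i - 1` and `i + 2`,
  -- and otherwise empty.
  let X : ι → Finset ℕ := fun p => if ∃ j, j + 1 = i ∧ j ∈ S p then P p ∩ {i} else ∅
  have hP : ∀ p j, j ∈ P p ↔ skipTwo i j ∈ S p := fun p j => Finset.mem_preimage
  have hX : ∀ p j, j ∈ X p ↔ (∃ j, j + 1 = i ∧ j ∈ S p) ∧ j = i ∧ i + 2 ∈ S p := by
    intro p j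
    simp only [X]
    split_ifs with h
    · rw [Finset.mem_inter, hP, Finset.mem_singleton]
      constructor
      · rintro ⟨h1, rfl⟩
        exact ⟨h, rfl, by rwa [skipTwo_of_le le_rfl] at h1⟩
      · rintro ⟨-, rfl, h1⟩
        exact ⟨by rwa [skipTwo_of_le le_rfl], rfl⟩
    · simp [h]
  have hXP : ∀ p, X p ⊆ P p := by
    intro p j hj
    obtain ⟨-, rfl, h⟩ := (hX p j).1 hj
    rwa [hP, skipTwo_of_le le_rfl]
  have hPn : ∀ p, ∀ j ∈ P p, j ≤ n := by
    intro p j hj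
    rw [hP] at hj
    have := (hS.1 p).1 _ hj
    rcases lt_or_ge j i with h | h
    · rw [skipTwo_of_lt h] at this hj
      by_contra hc
      omega
    · rw [skipTwo_of_le h] at this
      omega
  refine ⟨Sum.elim (fun p => P p \ X p) X, ⟨?_, fun j => ?_⟩, fun s => ?_⟩
  · rintro (p | p)
    · refine ⟨fun j hj => hPn p j (Finset.mem_sdiff.1 hj).1, fun j hj hj' => ?_⟩
      simp only [Sum.elim_inl, Finset.mem_sdiff] at hj hj'
      have h1 := (hP _ _).1 hj.1
      have h2 := (hP _ _).1 hj'.1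
      by_cases hji : j + 1 < i
      · rw [skipTwo_of_lt (by omega)] at h1 h2
        exact (hS.1 p).2 _ h1 h2
      · rw [skipTwo_of_le (by omega)] at h2
        by_cases hji' : j + 1 = i
        · rw [skipTwo_of_lt (by omega)] at h1
          exact hj'.2 ((hX _ _).2 ⟨⟨j, hji', h1⟩, hji', hji' ▸ h2⟩)
        · rw [skipTwo_of_le (by omega)] at h1
          exact (hS.1 p).2 _ h1 h2
    · refine ⟨fun j hj => hPn p j (hXP p hj), fun j hj hj' => ?_⟩
      have h1 := ((hX _ _).1 hj).2.1
      have h2 := ((hX _ _).1 hj').2.1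
      omega
  · rw [hab, ← hS.2, Finset.card_filter, Finset.card_filter, Fintype.sum_sum_type,
      ← Finset.sum_add_distrib]
    refine Finset.sum_congr rfl fun p _ => ?_
    simp only [Sum.elim_inl, Sum.elim_inr, Finset.mem_sdiff, ← hP]
    by_cases h1 : j ∈ P p <;> by_cases h2 : j ∈ X p
    · simp [h1, h2]
    · simp [h1, h2]
    · exact absurd (hXP p h2) h1
    · simp [h1, h2]
  · refine Finset.card_le_card_of_injOn Sum.inl (fun p hp => ?_) Sum.inl_injective.injOn
    simp only [Finset.coe_filter, Finset.mem_univ, true_and, Set.mem_ofPred_eq,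
      Sum.elim_inl] at hp ⊢
    have h1 : (S p).card ≤ (P p).card + _ := card_preimage_skipTwo i (hS.1 p)
    rw [Finset.card_sdiff_of_subset (hXP p)]
    by_cases h : ∃ x, x ∈ X p
    · obtain ⟨x, hx⟩ := h
      obtain ⟨⟨j, hj, hjS⟩, -, h2⟩ := (hX _ _).1 hx
      have h3 : i ∉ S p := hj ▸ (hS.1 p).2 _ hjS
      have h4 : i + 1 ∉ S p := fun h => (hS.1 p).2 _ h h2
      rw [if_neg (by tauto)] at h1
      have h5 : (X p).card ≤ 1 := Finset.card_le_one.2 fun x hx y hy => by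
        rw [((hX _ _).1 hx).2.1, ((hX _ _).1 hy).2.1]
      omega
    · have : X p = ∅ := Finset.eq_empty_of_forall_notMem fun x hx => h ⟨x, hx⟩
      rw [this, Finset.card_empty]
      split_ifs at h1 <;> omega

theorem HasFactorization.congr {n : ℕ} {μ : Mono n} {d e : ℕ → ℕ} (h : HasFactorization n μ d)
    (he : ∀ r ≤ n / 2, d r = e r) : HasFactorization n μ e := by
  obtain ⟨g, hg, hμ⟩ := h
  refine ⟨fun r t => if hr : r ≤ n / 2 then g r (Fin.cast (he r hr).symm t) else 0, ?_, ?_⟩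
  · intro r hr t
    simp only [dif_pos hr]
    exact hg r hr _
  · rw [hμ]
    refine Finset.sum_congr rfl fun r hr => ?_
    have hr : r ≤ n / 2 := Nat.le_of_lt_succ (Finset.mem_range.1 hr)
    simp only [dif_pos hr]
    exact ((finCongr (he r hr).symm).sum_comp (g r)).symm

theorem HasDegrees.congr {n : ℕ} {μ : Mono n} {d e : ℕ → ℕ} (h : HasDegrees n μ d)
    (he : ∀ r ≤ n / 2, d r = e r) : HasDegrees n μ e :=
  ⟨h.1.congr he, fun f hf r hr hs => by
    rw [← he r hr]
    exact h.2 f hf r hr fun s h1 h2 => (hs s h1 h2).trans (he s h2).symm⟩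

theorem HasDegrees.unique {n : ℕ} {μ : Mono n} {d e : ℕ → ℕ} (hd : HasDegrees n μ d)
    (he : HasDegrees n μ e) : ∀ r ≤ n / 2, d r = e r := by
  have key : ∀ k s, s + k = n / 2 + 1 → ∀ r, s ≤ r → r ≤ n / 2 → d r = e r := by
    intro k
    induction k with
    | zero => intro s hs r h1 h2; omega
    | succ k ih =>
      intro s hs r h1 h2
      have ih' := ih (s + 1) (by omega)
      rcases Nat.eq_or_lt_of_le h1 with rfl | h1
      · exact le_antisymm (he.2 d hd.1 s h2 fun u hu hu' => ih' u hu hu')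
          (hd.2 e he.1 s h2 fun u hu hu' => (ih' u hu hu').symm)
      · exact ih' r h1 h2
  exact fun r hr => key (n / 2 + 1) 0 (by omega) r (Nat.zero_le _) hr

/-- A factorization of `a` better than `d` would, after deletion, give one of `b` better than `D`.
Deletion need not preserve the size of each set, so numbers of sets of at least a given size are
compared, from the largest size down. -/
theorem IsDeletion.hasDegrees {n i : ℕ} {a : Mono (n + 2)} {b : Mono n}
    (hab : IsDeletion i a b) (hi : i ≤ n + 1) (hr : a.coeff (i + 2) ≤ a.coeff i)
    (hl : ∀ j, j + 1 = i → a.coeff j ≤ a.coeff (i + 1)) {D d : ℕ → ℕ}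
    (hD : HasDegrees n b D)
    (h0 : d 0 + ∑ r ∈ Finset.range (n / 2 + 1), D r = a.coeff i + a.coeff (i + 1))
    (hd : ∀ r ≤ n / 2, d (r + 1) = D r) : HasDegrees (n + 2) a d := by
  have hdf := hab.hasFactorization hi hr hl hD.1 h0 hd
  refine ⟨hdf, fun e he r hr hs => ?_⟩
  have hn : (n + 2) / 2 = n / 2 + 1 := by omega
  rw [hn] at hr hs
  rcases r with _ | r
  -- Once all the other numbers agree, the degree of the monomial determines the number of linear
  -- factors.
  · have h1 := he.degree_eq
    rw [hdf.degree_eq, Finset.sum_range_succ', Finset.sum_range_succ' _ ((n + 2) / 2)] at h1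
    have h2 : ∑ k ∈ Finset.range ((n + 2) / 2), (k + 1 + 1) * d (k + 1) =
        ∑ k ∈ Finset.range ((n + 2) / 2), (k + 1 + 1) * e (k + 1) :=
      Finset.sum_congr rfl fun k hk => by
        rw [hs (k + 1) (by omega) (by have := Finset.mem_range.1 hk; omega)]
    rw [h2] at h1
    omega
  · by_contra! hlt
    rw [hd r (by omega)] at hlt
    obtain ⟨S, hS, hSc⟩ := he.exists_cover
    obtain ⟨U, hU, hUc⟩ := hD.1.exists_cover
    obtain ⟨T, hT, hTS⟩ := hab.exists_cover hS hi
    have hcS : ∀ s ≤ n / 2 + 1, (Finset.univ.filter fun p => (S p).card = s + 1).card = e s := by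
      intro s hs
      rw [Finset.card_filter, Fintype.sum_sigma,
        Finset.sum_eq_single (⟨s, by omega⟩ : Fin ((n + 2) / 2 + 1))]
      · simp [hSc]
      · intro r' _ hne
        have : (r' : ℕ) ≠ s := fun h => hne (Fin.ext h)
        simp [hSc, this]
      · simp
    have hcU : ∀ s ≤ n / 2, (Finset.univ.filter fun p => (U p).card = s + 1).card = D s := by
      intro s hs
      rw [Finset.card_filter, Fintype.sum_sigma,
        Finset.sum_eq_single (⟨s, by omega⟩ : Fin (n / 2 + 1))]
      · simp [hUc]
      · intro r' _ hne
        have : (r' : ℕ) ≠ s := fun h => hne (Fin.ext h)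
        simp [hUc, this]
      · simp
    let f : ℕ → ℕ := fun s => (Finset.univ.filter fun p => (T p).card = s + 1).card
    have hf : HasFactorization n b f := hasFactorization_of_cover hT fun _ _ => rfl
    have hTr : ∀ s, atLeast T (s + 1) = f s + atLeast T (s + 2) := fun s => atLeast_eq_add T (s + 1)
    have hSr : ∀ s ≤ n / 2 + 1, atLeast S (s + 1) = e s + atLeast S (s + 2) := fun s h =>
      (atLeast_eq_add S (s + 1)).trans (by rw [hcS s h])
    have hUr : ∀ s ≤ n / 2, atLeast U (s + 1) = D s + atLeast U (s + 2) := fun s h =>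
      (atLeast_eq_add U (s + 1)).trans (by rw [hcU s h])
    -- Above level `r`, the inequality `atLeast S (s + 1) ≤ atLeast T s` and the maximality of `D`
    -- squeeze `f` to equality with `D`. At level `r` the same comparison contradicts `hlt`.
    have key : ∀ k s, s + k = n / 2 + 1 → r < s → atLeast T (s + 1) = atLeast U (s + 1) ∧
        atLeast S (s + 2) = atLeast U (s + 1) ∧ ∀ u, s ≤ u → u ≤ n / 2 → f u = D u := by
      intro k
      induction k with
      | zero =>
        intro s hsk _
        obtain rfl : s = n / 2 + 1 := by omega
        rw [hT.atLeast_eq_zero (by omega), hU.atLeast_eq_zero (by omega),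
          hS.atLeast_eq_zero (by omega)]
        exact ⟨rfl, rfl, fun u h1 h2 => by omega⟩
      | succ k ih =>
        intro s hsk hrs
        obtain ⟨h1, h2, h3⟩ := ih (s + 1) (by omega) (by omega)
        have h4 := hD.2 f hf s (by omega) fun u hu hu' => h3 u hu hu'
        have h5 := hTr s
        have h6 := hUr s (by omega)
        have h7 := hSr (s + 1) (by omega)
        have h8 := hTS (s + 1)
        have h9 := hs (s + 1) (by omega) (by omega)
        rw [hd s (by omega)] at h9
        simp only [add_assoc, Nat.reduceAdd] at *
        refine ⟨by omega, by omega, fun u hu hu' => ?_⟩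
        rcases Nat.eq_or_lt_of_le hu with rfl | hu
        · omega
        · exact h3 u hu hu'
    obtain ⟨h1, h2, h3⟩ := key (n / 2 - r) (r + 1) (by omega) (by omega)
    have h4 := hD.2 f hf r (by omega) fun u hu hu' => h3 u hu hu'
    have h5 := hTr r
    have h6 := hUr r (by omega)
    have h7 := hSr (r + 1) (by omega)
    have h8 := hTS (r + 1)
    simp only [add_assoc, Nat.reduceAdd] at *
    omega

/-! ### Recursion for the degrees -/

/-- The pair `(i, i + 1)` maximizes the sum of two consecutive exponents of `a`. -/
def IsMaxPair {n : ℕ} (i : ℕ) (a : Mono (n + 2)) : Prop :=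
  i ≤ n + 1 ∧ ∀ j, a.coeff j + a.coeff (j + 1) ≤ a.coeff i + a.coeff (i + 1)

theorem exists_isMaxPair {n : ℕ} (a : Mono (n + 2)) : ∃ i, IsMaxPair i a := by
  obtain ⟨i, hi, h⟩ := (Finset.range (n + 2)).exists_max_image
    (fun j => a.coeff j + a.coeff (j + 1)) ⟨0, by simp⟩
  have hi := Finset.mem_range.1 hi
  refine ⟨i, by omega, fun j => ?_⟩
  by_cases hj : j < n + 2
  · exact h j (Finset.mem_range.2 hj)
  · have h1 := h (n + 1) (by simp)
    have h2 := a.coeff_of_lt (i := j + 1) (by omega)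
    rcases Nat.eq_or_lt_of_le (not_lt.1 hj) with rfl | hj
    · simp only [add_assoc, Nat.reduceAdd] at *
      omega
    · have h3 := a.coeff_of_lt hj
      omega

theorem exists_isDeletion {n i : ℕ} (hi : i ≤ n + 1) (a : Mono (n + 2)) :
    ∃ b : Mono n, IsDeletion i a b := by
  refine ⟨Mono.ofCoeff n fun j => a.coeff (skipTwo i j), fun j => ?_⟩
  rw [Mono.coeff_ofCoeff]
  intro j hj
  rw [skipTwo_of_le (by omega), a.coeff_of_lt (by omega)]

/-- The only new adjacent pair is `(a_{i-1}, a_{i+2})`, and `a_{i-1} ≤ a_{i+1}`, `a_{i+2} ≤ a_i` by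
maximality. -/
theorem IsMaxPair.pair_le {n i : ℕ} {a : Mono (n + 2)} {b : Mono n} (hi : IsMaxPair i a)
    (hab : IsDeletion i a b) (j : ℕ) :
    b.coeff j + b.coeff (j + 1) ≤ a.coeff i + a.coeff (i + 1) := by
  rcases lt_trichotomy (j + 1) i with h | h | h
  · rw [hab.coeff_of_lt h, hab.coeff_of_lt (by omega)]
    exact hi.2 j
  · rw [hab.coeff_of_lt (by omega), hab.coeff_of_le h.ge]
    have h1 := hi.2 j
    have h2 := hi.2 (i + 1)
    rw [h] at h1 ⊢
    simp only [add_assoc, Nat.reduceAdd] at *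
    omega
  · rw [hab.coeff_of_le (by omega), hab.coeff_of_le (by omega)]
    exact hi.2 (j + 2)

theorem IsMaxPair.hasDegrees {n i : ℕ} {a : Mono (n + 2)} {b : Mono n} (hi : IsMaxPair i a)
    (hab : IsDeletion i a b) {D d : ℕ → ℕ} (hD : HasDegrees n b D)
    (h0 : d 0 + ∑ r ∈ Finset.range (n / 2 + 1), D r = a.coeff i + a.coeff (i + 1))
    (hd : ∀ r ≤ n / 2, d (r + 1) = D r) : HasDegrees (n + 2) a d := by
  refine hab.hasDegrees hi.1 ?_ ?_ hD h0 hd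
  · have := hi.2 (i + 1)
    simp only [add_assoc, Nat.reduceAdd] at *
    omega
  · rintro j rfl
    have := hi.2 j
    omega

theorem hasFactorization_linear {n : ℕ} (μ : Mono n) :
    HasFactorization n μ fun r => if r = 0 then μ.degree else 0 := by
  refine hasFactorization_of_cover (ι := (j : Fin (n + 1)) × Fin (μ.coeff j))
    (S := fun p => {(p.1 : ℕ)}) ⟨fun p => ⟨?_, ?_⟩, fun j => ?_⟩ fun r _ => ?_
  · intro i hi
    rw [Finset.mem_singleton.1 hi]
    omega
  · intro i hi
    simp [Finset.mem_singleton.1 hi]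
  · by_cases hj : j < n + 1
    · rw [Finset.card_filter, Fintype.sum_sigma, Finset.sum_eq_single (⟨j, hj⟩ : Fin (n + 1))]
      · simp
      · intro j' _ hne
        have : j ≠ (j' : ℕ) := fun h => hne (Fin.ext h.symm)
        simp [this]
      · simp
    · rw [μ.coeff_of_lt (by omega), Finset.card_eq_zero, Finset.filter_eq_empty_iff]
      rintro ⟨j', _⟩ _ h
      have := Finset.mem_singleton.1 h
      have := j'.isLt
      simp only at *
      omega
  · rcases r with _ | r
    · simp [Mono.degree_eq_sum_range, Finset.sum_range]
    · simp

theorem hasDegrees_of_le_one {n : ℕ} (hn : n ≤ 1) (μ : Mono n) {d : ℕ → ℕ} :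
    HasDegrees n μ d ↔ d 0 = μ.degree := by
  have h2 : n / 2 = 0 := by omega
  have hf : ∀ e, HasFactorization n μ e → e 0 = μ.degree := fun e he => by
    rw [he.degree_eq, h2]; simp
  refine ⟨fun h => hf d h.1, fun h => ⟨(hasFactorization_linear μ).congr fun r hr => ?_,
    fun e he r hr _ => ?_⟩⟩
  · obtain rfl : r = 0 := by omega
    simp [h]
  · obtain rfl : r = 0 := by omega
    rw [hf e he, h]

/-- The two extra clauses say that the total number of factors is the largest sum of two consecutive
exponents. They are carried through the recursion to ensure that the new `d 0` is nonnegative. -/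
theorem exists_hasDegrees : ∀ {n : ℕ} (μ : Mono n), ∃ d, HasDegrees n μ d ∧
    (∀ j, μ.coeff j + μ.coeff (j + 1) ≤ ∑ r ∈ Finset.range (n / 2 + 1), d r) ∧
    ∃ j, μ.coeff j + μ.coeff (j + 1) = ∑ r ∈ Finset.range (n / 2 + 1), d r
  | 0, μ => by
    have h1 : μ.degree = μ.coeff 0 := by simp [Mono.degree_eq_sum_range]
    have h2 : ∀ j, μ.coeff (j + 1) = 0 := fun j => μ.coeff_of_lt (by omega)
    refine ⟨fun _ => μ.degree, (hasDegrees_of_le_one (by omega) μ).2 rfl, fun j => ?_, 0, ?_⟩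
    · rcases j with _ | j <;> simp [h1, h2]
    · simp [h1, h2]
  | 1, μ => by
    have h1 : μ.degree = μ.coeff 0 + μ.coeff 1 := by
      simp [Mono.degree_eq_sum_range, Finset.sum_range_succ]
    have h2 : ∀ j, μ.coeff (j + 2) = 0 := fun j => μ.coeff_of_lt (by omega)
    refine ⟨fun _ => μ.degree, (hasDegrees_of_le_one le_rfl μ).2 rfl, fun j => ?_, 0, ?_⟩
    · rcases j with _ | _ | j <;> simp [h1, h2]
    · simp [h1]
  | n + 2, μ => by
    obtain ⟨i, hi⟩ := exists_isMaxPair μ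
    obtain ⟨b, hb⟩ := exists_isDeletion hi.1 μ
    obtain ⟨D, hD, -, j, hj⟩ := exists_hasDegrees b
    have hle := hi.pair_le hb j
    -- The subtraction is not truncated: the sum of `D` is a pair sum of `b`, hence at most the
    -- maximal pair sum of `μ`.
    let d : ℕ → ℕ := fun r => Nat.casesOn r
      (μ.coeff i + μ.coeff (i + 1) - ∑ r ∈ Finset.range (n / 2 + 1), D r) D
    have h0 : d 0 + ∑ r ∈ Finset.range (n / 2 + 1), D r = μ.coeff i + μ.coeff (i + 1) :=
      Nat.sub_add_cancel (hj.symm.trans_le hle)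
    have hs : ∑ r ∈ Finset.range ((n + 2) / 2 + 1), d r = μ.coeff i + μ.coeff (i + 1) := by
      rw [← h0, show (n + 2) / 2 = n / 2 + 1 by omega, Finset.sum_range_succ', add_comm]
    exact ⟨d, hi.hasDegrees hb hD h0 fun r _ => rfl, fun j => hs ▸ hi.2 j, i, hs.symm⟩

theorem HasDegrees.pair_le {n : ℕ} {μ : Mono n} {d : ℕ → ℕ} (h : HasDegrees n μ d) (j : ℕ) :
    μ.coeff j + μ.coeff (j + 1) ≤ ∑ r ∈ Finset.range (n / 2 + 1), d r := by
  obtain ⟨e, he, h1, -⟩ := exists_hasDegrees μ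
  refine (h1 j).trans_eq (Finset.sum_congr rfl fun r hr => ?_)
  exact he.unique h r (Nat.le_of_lt_succ (Finset.mem_range.1 hr))

theorem IsMaxPair.hasDegrees_iff {n i : ℕ} {a : Mono (n + 2)} {b : Mono n} (hi : IsMaxPair i a)
    (hab : IsDeletion i a b) {d : ℕ → ℕ} :
    HasDegrees (n + 2) a d ↔
      ∑ r ∈ Finset.range (n / 2 + 2), d r = a.coeff i + a.coeff (i + 1) ∧
      HasDegrees n b fun r => d (r + 1) := by
  have hn : (n + 2) / 2 = n / 2 + 1 := by omega
  constructor
  · intro h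
    obtain ⟨D, hD, -, j, hj⟩ := exists_hasDegrees b
    have hle := hi.pair_le hab j
    let d' : ℕ → ℕ := fun r => Nat.casesOn r
      (a.coeff i + a.coeff (i + 1) - ∑ r ∈ Finset.range (n / 2 + 1), D r) D
    have h0 : d' 0 + ∑ r ∈ Finset.range (n / 2 + 1), D r = a.coeff i + a.coeff (i + 1) :=
      Nat.sub_add_cancel (hj.symm.trans_le hle)
    have heq := h.unique (hi.hasDegrees hab hD h0 fun r _ => rfl)
    refine ⟨?_, hD.congr fun r hr => (heq (r + 1) (by omega)).symm⟩
    rw [← h0, Finset.sum_range_succ', heq 0 (by omega), add_comm]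
    congr 1
    refine Finset.sum_congr rfl fun r hr => ?_
    have := Finset.mem_range.1 hr
    exact heq (r + 1) (by omega)
  · rintro ⟨h1, h2⟩
    refine hi.hasDegrees hab h2 ?_ fun r _ => rfl
    rw [← h1, Finset.sum_range_succ' d, add_comm]

/-! ### The chain of insertions of a pair -/

namespace Mono

variable {n : ℕ}

/-- Insert two exponents `x`, `y` in front of the exponent of `z_i`. -/
noncomputable def insertPair (b : Mono n) (i x y : ℕ) : Mono (n + 2) :=
  ofCoeff (n + 2) fun j =>
    if j < i then b.coeff j else if j = i then x else if j = i + 1 then y else b.coeff (j - 2)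

theorem coeff_insertPair (b : Mono n) {i : ℕ} (hi : i ≤ n + 1) (x y j : ℕ) :
    (b.insertPair i x y).coeff j =
      if j < i then b.coeff j else if j = i then x else if j = i + 1 then y
        else b.coeff (j - 2) := by
  rw [insertPair, coeff_ofCoeff]
  intro j hj
  rw [if_neg (by omega), if_neg (by omega), if_neg (by omega), b.coeff_of_lt (by omega)]

theorem isDeletion_insertPair (b : Mono n) {i : ℕ} (hi : i ≤ n + 1) (x y : ℕ) :
    IsDeletion i (b.insertPair i x y) b := by
  intro j
  rw [coeff_insertPair b hi]
  rcases lt_or_ge j i with h | h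
  · rw [skipTwo_of_lt h, if_pos h]
  · rw [skipTwo_of_le h, if_neg (by omega), if_neg (by omega), if_neg (by omega)]
    simp

theorem eq_insertPair {i : ℕ} {a : Mono (n + 2)} {b : Mono n} (h : IsDeletion i a b)
    (hi : i ≤ n + 1) : a = b.insertPair i (a.coeff i) (a.coeff (i + 1)) := by
  apply coeff_injective
  ext j
  rw [coeff_insertPair b hi]
  split_ifs with h1 h2 h3
  · rw [h.coeff_of_lt h1]
  · rw [h2]
  · rw [h3]
  · rw [h.coeff_of_le (by omega)]
    congr 1
    omega

theorem prefixSum_insertPair (b : Mono n) {i : ℕ} (hi : i ≤ n + 1) (x y j : ℕ) :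
    (b.insertPair i x y).prefixSum j =
      if j ≤ i then b.prefixSum j else if j = i + 1 then b.prefixSum i + x
        else b.prefixSum (j - 2) + x + y := by
  induction j with
  | zero => simp [prefixSum_zero]
  | succ j ih =>
    rw [prefixSum_succ, ih, coeff_insertPair b hi]
    rcases lt_trichotomy j i with h | rfl | h
    · rw [if_pos h.le, if_pos h, if_pos (by omega), prefixSum_succ]
    · simp
    · rw [if_neg (by omega : ¬ j ≤ i), if_neg (by omega : ¬ j < i), if_neg (by omega : ¬ j = i),
        if_neg (by omega : ¬ j + 1 ≤ i), if_neg (by omega : ¬ j + 1 = i + 1)]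
      by_cases h' : j = i + 1
      · subst h'; simp
      · rw [if_neg h', if_neg h']
        have h1 : j + 1 - 2 = (j - 2) + 1 := by omega
        rw [h1, prefixSum_succ]
        omega

theorem degree_insertPair (b : Mono n) {i : ℕ} (hi : i ≤ n + 1) (x y : ℕ) :
    (b.insertPair i x y).degree = b.degree + (x + y) := by
  rw [← prefixSum_of_lt _ (show n + 2 < n + 3 by omega), prefixSum_insertPair b hi,
    if_neg (by omega), if_neg (by omega), prefixSum_of_lt _ (by omega), add_assoc]

theorem weight_insertPair (b : Mono n) {i : ℕ} (hi : i ≤ n + 1) (x y : ℕ) :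
    (b.insertPair i x y).weight = b.weight + 4 * b.prefixSum i - 2 * b.degree +
      (x + y) * (n + 2 - 2 * i) - 2 * y := by
  obtain ⟨m, hm⟩ : ∃ m, n + 1 = i + m := ⟨n + 1 - i, by omega⟩
  have hn : n + 2 + 1 = i + (m + 2) := by omega
  have hc := coeff_insertPair b hi x y
  have h1 : ∑ j ∈ Finset.range i, ((b.insertPair i x y).coeff j : ℤ) * (((n + 2 : ℕ) : ℤ) - 2 * j) =
      ∑ j ∈ Finset.range i, (b.coeff j : ℤ) * ((n : ℤ) - 2 * j) +
        2 * ∑ j ∈ Finset.range i, (b.coeff j : ℤ) := by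
    rw [Finset.mul_sum, ← Finset.sum_add_distrib]
    refine Finset.sum_congr rfl fun j hj => ?_
    rw [hc, if_pos (Finset.mem_range.1 hj)]
    push_cast
    ring
  have h2 : ∑ j ∈ Finset.range m, ((b.insertPair i x y).coeff (i + (j + 1 + 1)) : ℤ) *
        (((n + 2 : ℕ) : ℤ) - 2 * ((i + (j + 1 + 1) : ℕ) : ℤ)) =
      ∑ j ∈ Finset.range m, (b.coeff (i + j) : ℤ) * ((n : ℤ) - 2 * ((i + j : ℕ) : ℤ)) -
        2 * ∑ j ∈ Finset.range m, (b.coeff (i + j) : ℤ) := by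
    rw [Finset.mul_sum, ← Finset.sum_sub_distrib]
    refine Finset.sum_congr rfl fun j _ => ?_
    rw [hc, if_neg (by omega), if_neg (by omega), if_neg (by omega),
      show i + (j + 1 + 1) - 2 = i + j by omega]
    push_cast
    ring
  have h3 : (b.degree : ℤ) =
      b.prefixSum i + ∑ j ∈ Finset.range m, (b.coeff (i + j) : ℤ) := by
    rw [degree_eq_sum_range, hm, Finset.sum_range_add, prefixSum]
    push_cast
    ring
  have h4 : (b.prefixSum i : ℤ) = ∑ j ∈ Finset.range i, (b.coeff j : ℤ) := by
    simp [prefixSum]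
  rw [weight_eq_sum_range, weight_eq_sum_range, hn, hm, Finset.sum_range_add _ i (m + 2),
    Finset.sum_range_add _ i m,
    h1, Finset.sum_range_succ' _ (m + 1), Finset.sum_range_succ' _ m, h2, hc, hc, if_neg (by omega),
    if_neg (by omega), if_pos rfl, if_neg (by omega), if_pos (show i + 0 = i from rfl), h3, h4]
  push_cast
  ring

/-- `a` is the `t`-th element of the chain of monomials which arise from `b` by inserting a pair
of exponents of sum `J`, where `J` is not exceeded by any other sum of two consecutive exponents. -/
def IsInsertion (b : Mono n) (J t : ℕ) (a : Mono (n + 2)) : Prop :=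
  ∃ i x y, i ≤ n + 1 ∧ x + y = J ∧ b.coeff i ≤ x ∧ (∀ j, j + 1 = i → b.coeff j ≤ y) ∧
    t + x + 2 * b.prefixSum i = (i + 1) * J ∧ a = b.insertPair i x y

/-- The least `t` for which the `t`-th insertion into `b` can be made in front of `z_j`. -/
def breakpoint (b : Mono n) (J j : ℕ) : ℤ := j * J - b.prefixSum j - b.prefixSum (j - 1)

theorem breakpoint_zero (b : Mono n) (J : ℕ) : b.breakpoint J 0 = 0 := by
  simp [breakpoint, prefixSum_zero]

theorem breakpoint_last (b : Mono n) (J : ℕ) :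
    b.breakpoint J (n + 2) = (n + 2) * J - 2 * b.degree := by
  rw [breakpoint, prefixSum_of_lt _ (by omega), prefixSum_of_lt _ (by omega)]
  push_cast
  ring

/-- Consecutive breakpoints differ by `J - b_{j-1} - b_j`, where `b_{-1} = 0`. -/
theorem breakpoint_mono {b : Mono n} {J : ℕ} (hJ : ∀ j, b.coeff j + b.coeff (j + 1) ≤ J) :
    Monotone (b.breakpoint J) := by
  refine monotone_nat_of_le_succ fun j => ?_
  simp only [breakpoint]
  rcases j with _ | j
  · have := hJ 0
    have h1 := b.prefixSum_succ 0
    simp only [prefixSum_zero, Nat.cast_add, Nat.cast_one] at *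
    simp only [Nat.add_sub_cancel, prefixSum_zero, zero_tsub]
    push_cast
    linarith
  · have := hJ j
    have h1 := b.prefixSum_succ j
    have h2 := b.prefixSum_succ (j + 1)
    simp only [Nat.add_sub_cancel]
    push_cast
    zify at this h1 h2
    linarith

theorem IsInsertion.mem_breakpoint {b : Mono n} {i x y J t : ℕ} (hxy : x + y = J)
    (hx : b.coeff i ≤ x) (hy : ∀ j, j + 1 = i → b.coeff j ≤ y)
    (ht : t + x + 2 * b.prefixSum i = (i + 1) * J) :
    b.breakpoint J i ≤ t ∧ t ≤ b.breakpoint J (i + 1) := by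
  have h1 := b.prefixSum_succ i
  constructor
  · rcases i with _ | i
    · rw [breakpoint_zero]; positivity
    · have h2 := hy i rfl
      have h3 := b.prefixSum_succ i
      simp only [breakpoint, Nat.add_sub_cancel]
      zify at *
      linarith
  · simp only [breakpoint, Nat.add_sub_cancel]
    zify at *
    linarith

/-- The three terms are the values when the inserted pair lies to the right of the cut, to its left,
or is split by it. As `i`, `x`, `y` do not occur, the insertion depends on `t` alone; as the formula
is antitone in `t`, the insertions increase. -/
theorem IsInsertion.prefixSum_eq {b : Mono n} {J t : ℕ} {a : Mono (n + 2)}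
    (hJ : ∀ j, b.coeff j + b.coeff (j + 1) ≤ J) (h : IsInsertion b J t a) (j : ℕ) :
    (a.prefixSum j : ℤ) = max (b.prefixSum j : ℤ)
      (min (J + b.prefixSum (j - 2)) (j * J - b.prefixSum (j - 1) - t)) := by
  obtain ⟨i, x, y, hi, hxy, hx, hy, ht, rfl⟩ := h
  obtain ⟨h1, h2⟩ := IsInsertion.mem_breakpoint hxy hx hy ht
  have hmono := breakpoint_mono hJ
  rw [prefixSum_insertPair b hi]
  have hBJ : b.prefixSum j ≤ J + b.prefixSum (j - 2) := by
    rcases j with _ | _ | j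
    · simp [prefixSum_zero]
    · have := hJ 0
      simp [prefixSum_succ, prefixSum_zero]
      omega
    · have := hJ j
      have e : j + 1 + 1 - 2 = j := rfl
      simp only [prefixSum_succ, e]
      omega
  split_ifs with c1 c2
  · have h3 := hmono c1
    simp only [breakpoint] at h3 h1
    rw [max_eq_left]
    exact (min_le_right _ _).trans (by linarith)
  · subst c2
    have h3 := b.prefixSum_succ i
    have h4 : ((b.prefixSum i + x : ℕ) : ℤ) =
        ((i + 1 : ℕ) : ℤ) * J - b.prefixSum (i + 1 - 1) - t := by
      simp only [Nat.add_sub_cancel]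
      zify at *
      linarith
    rw [h4, min_eq_right, max_eq_right]
    · simp only [Nat.add_sub_cancel] at *
      zify at *
      linarith
    · have h5 : b.prefixSum i + x ≤ J + b.prefixSum (i + 1 - 2) := by
        rcases i with _ | i
        · simp [prefixSum_zero]; omega
        · have := hy i rfl
          simp only [prefixSum_succ, Nat.reduceSubDiff]
          omega
      rw [← h4]
      exact_mod_cast h5
  · obtain ⟨j, rfl⟩ : ∃ j', j = j' + 2 := ⟨j - 2, by omega⟩
    have h3 := hmono (show i + 1 ≤ j + 1 by omega)
    simp only [breakpoint, Nat.add_sub_cancel] at h3 h2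
    have e : j + 2 - 1 = j + 1 := rfl
    rw [min_eq_left, max_eq_right, Nat.add_sub_cancel, add_assoc, hxy]
    · push_cast; ring
    · exact_mod_cast hBJ
    · simp only [Nat.add_sub_cancel, e]
      push_cast at *
      linarith

theorem IsInsertion.unique {b : Mono n} {J t : ℕ} {a a' : Mono (n + 2)}
    (hJ : ∀ j, b.coeff j + b.coeff (j + 1) ≤ J) (h : IsInsertion b J t a)
    (h' : IsInsertion b J t a') : a = a' := by
  apply prefixSum_injective
  ext j
  zify
  rw [h.prefixSum_eq hJ, h'.prefixSum_eq hJ]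

theorem IsInsertion.degree_eq {b : Mono n} {J t : ℕ} {a : Mono (n + 2)}
    (h : IsInsertion b J t a) : a.degree = b.degree + J := by
  obtain ⟨i, x, y, hi, hxy, -, -, -, rfl⟩ := h
  rw [degree_insertPair b hi, hxy]

theorem IsInsertion.weight_eq {b : Mono n} {J t : ℕ} {a : Mono (n + 2)}
    (h : IsInsertion b J t a) :
    a.weight = b.weight + ((n + 2) * J - 2 * b.degree) - 2 * t := by
  obtain ⟨i, x, y, hi, hxy, -, -, ht, rfl⟩ := h
  rw [weight_insertPair b hi]
  subst hxy
  zify at ht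
  push_cast
  linear_combination (2 : ℤ) * ht

theorem IsInsertion.le {b : Mono n} {J t : ℕ} (hJ : ∀ j, b.coeff j + b.coeff (j + 1) ≤ J)
    {a a' : Mono (n + 2)} (h : IsInsertion b J t a) (h' : IsInsertion b J (t + 1) a') : a ≤ a' := by
  refine le_iff_prefixSum.2 ⟨h.degree_eq.trans h'.degree_eq.symm, fun j => ?_⟩
  zify
  rw [h.prefixSum_eq hJ, h'.prefixSum_eq hJ]
  refine max_le_max le_rfl (min_le_min le_rfl ?_)
  push_cast
  linarith

theorem IsInsertion.covBy {b : Mono n} {J t : ℕ} (hJ : ∀ j, b.coeff j + b.coeff (j + 1) ≤ J)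
    {a a' : Mono (n + 2)} (h : IsInsertion b J t a) (h' : IsInsertion b J (t + 1) a') : a ⋖ a' := by
  refine covBy_of_le_of_weight (h.le hJ h') ?_
  rw [h.weight_eq, h'.weight_eq]
  push_cast
  ring

theorem exists_isInsertion {b : Mono n} {J t : ℕ} (ht : t + 2 * b.degree ≤ (n + 2) * J) :
    ∃ a, IsInsertion b J t a := by
  classical
  -- This is `breakpoint J j ≤ t` without subtraction; the last such `j` is the place of insertion.
  let P : ℕ → Prop := fun j => j * J ≤ b.prefixSum j + b.prefixSum (j - 1) + t
  have h0 : P 0 := by simp [P]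
  have hP : P (Nat.findGreatest P (n + 1)) := Nat.findGreatest_spec (Nat.zero_le _) h0
  have hi := Nat.findGreatest_le (P := P) (n + 1)
  have hnext : t + b.prefixSum (Nat.findGreatest P (n + 1) + 1) +
      b.prefixSum (Nat.findGreatest P (n + 1)) ≤ (Nat.findGreatest P (n + 1) + 1) * J := by
    rcases Nat.eq_or_lt_of_le hi with h | h
    · rw [h, prefixSum_of_lt _ (by omega), prefixSum_of_lt _ (by omega)]
      linarith
    · have hlt : ∀ j, ¬ P (j + 1) → t + b.prefixSum (j + 1) + b.prefixSum j ≤ (j + 1) * J := by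
        intro j hj
        simp only [P, Nat.add_sub_cancel] at hj
        omega
      exact hlt _ (Nat.findGreatest_is_greatest (Nat.lt_succ_self _) h)
  generalize Nat.findGreatest P (n + 1) = i at *
  simp only [P] at hP
  have h1 := b.prefixSum_succ i
  have h2 : (i + 1) * J = i * J + J := by ring
  have h3 := b.prefixSum_mono (Nat.sub_le i 1)
  refine ⟨_, i, (i + 1) * J - 2 * b.prefixSum i - t, J - ((i + 1) * J - 2 * b.prefixSum i - t),
    hi, ?_, ?_, ?_, ?_, rfl⟩
  · omega
  · omega
  · rintro j rfl
    have h4 := b.prefixSum_succ j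
    simp only [Nat.add_sub_cancel] at *
    omega
  · omega

theorem IsInsertion.of_bottom {b : Mono n} {J t : ℕ} (ht : t + b.coeff 0 ≤ J) :
    IsInsertion b J t (b.insertPair 0 (J - t) t) := by
  refine ⟨0, J - t, t, by omega, by omega, by omega, by omega, ?_, rfl⟩
  simp [prefixSum_zero]
  omega

theorem IsInsertion.of_top {b : Mono n} {J t u : ℕ} (hu : u + b.coeff n ≤ J)
    (ht : t + u + 2 * b.degree = (n + 2) * J) :
    IsInsertion b J t (b.insertPair (n + 1) u (J - u)) := by
  refine ⟨n + 1, u, J - u, le_rfl, by omega, ?_, ?_, ?_, rfl⟩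
  · rw [b.coeff_of_lt (by omega)]; omega
  · intro j hj
    obtain rfl : j = n := by omega
    omega
  · rw [prefixSum_of_lt _ (by omega)]
    exact ht

theorem insertPair_le_insertPair {b b' : Mono n} (h : b ≤ b') {i : ℕ} (hi : i ≤ n + 1) (x y : ℕ) :
    b.insertPair i x y ≤ b'.insertPair i x y := by
  obtain ⟨h1, h2⟩ := le_iff_prefixSum.1 h
  refine le_iff_prefixSum.2 ⟨by rw [degree_insertPair b hi, degree_insertPair b' hi, h1],
    fun j => ?_⟩
  rw [prefixSum_insertPair b hi, prefixSum_insertPair b' hi]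
  split_ifs
  · exact h2 j
  · exact Nat.add_le_add_right (h2 i) _
  · have := h2 (j - 2)
    omega

/-- The slack `D` lets the pair be inserted at the far left when `t ≤ D`, and at the far right when
`t` is within `D` of the end. There both monomials receive the same pair at the same place, so the
order is preserved; the weights then force a cover. -/
theorem IsInsertion.covBy_of_covBy {b b' : Mono n} (hb : b ⋖ b') {J t D : ℕ}
    (hJ : ∀ j, b.coeff j + b.coeff (j + 1) + D ≤ J)
    (hJ' : ∀ j, b'.coeff j + b'.coeff (j + 1) + D ≤ J)
    (ht : t ≤ D ∨ ∃ u ≤ D, t + u + 2 * b.degree = (n + 2) * J) {a a' : Mono (n + 2)}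
    (h : IsInsertion b J t a) (h' : IsInsertion b' J t a') : a ⋖ a' := by
  have hd := hb.le.1
  have hle : a ≤ a' := by
    rcases ht with ht | ⟨u, hu, ht⟩
    · have h1 := hJ 0
      have h2 := hJ' 0
      rw [h.unique (fun j => (Nat.le_add_right _ _).trans (hJ j)) (.of_bottom (by omega)),
        h'.unique (fun j => (Nat.le_add_right _ _).trans (hJ' j)) (.of_bottom (by omega))]
      exact insertPair_le_insertPair hb.le (Nat.zero_le _) _ _
    · have h1 := hJ n
      have h2 := hJ' n
      rw [h.unique (fun j => (Nat.le_add_right _ _).trans (hJ j)) (.of_top (u := u) (by omega) ht),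
        h'.unique (fun j => (Nat.le_add_right _ _).trans (hJ' j))
          (.of_top (u := u) (by omega) (by rw [← hd]; exact ht))]
      exact insertPair_le_insertPair hb.le le_rfl _ _
  refine covBy_of_le_of_weight hle ?_
  rw [h.weight_eq, h'.weight_eq, weight_of_covBy hb, hd]
  ring

theorem IsInsertion.isMaxPair {b : Mono n} {i x y : ℕ}
    (hJ : ∀ j, b.coeff j + b.coeff (j + 1) ≤ x + y) (hi : i ≤ n + 1)
    (hx : b.coeff i ≤ x) (hy : ∀ j, j + 1 = i → b.coeff j ≤ y) :
    IsMaxPair i (b.insertPair i x y) := by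
  refine ⟨hi, fun j => ?_⟩
  have h0 := hJ j
  have h2 := hJ (j - 2)
  have h3 := hy j
  simp only [coeff_insertPair b hi]
  rcases lt_or_ge j (i + 2) with h | h
  · by_cases h1 : j = i + 1
    · subst h1
      simp [show ¬ i + 1 + 1 < i by omega, show i + 1 + 1 ≠ i by omega]
      omega
    · by_cases h1 : j = i
      · subst h1; simp
      · by_cases h1 : j + 1 = i
        · subst h1; simp; omega
        · simp [show j < i by omega, show j + 1 < i by omega]
          exact h0
  · simp [show ¬ j < i by omega, show ¬ j + 1 < i by omega, show j ≠ i by omega,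
      show j ≠ i + 1 by omega, show j + 1 ≠ i by omega, show j - 1 = j - 2 + 1 by omega]
    exact h2

/-- If the places differ by at least two, the pair inserted into `b'` is an adjacent pair of `b`,
whose sum is too small. If they differ by one, the overlap of the pairs forces `b_i = b'_i`. -/
theorem insertPair_left_eq {b b' : Mono n} {i i' x y x' y' : ℕ} (hi : i ≤ i') (hi' : i' ≤ n + 1)
    (hJ : ∀ j, b.coeff j + b.coeff (j + 1) < x + y) (hxy : x + y = x' + y')
    (h : b.insertPair i x y = b'.insertPair i' x' y') : b = b' := by
  have hb := b.isDeletion_insertPair (hi.trans hi') x y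
  have hb' := b'.isDeletion_insertPair hi' x' y'
  have hc := congrArg coeff h
  have hx : ∀ j, _ = _ := fun j => congrFun hc j
  simp only [coeff_insertPair b (hi.trans hi'), coeff_insertPair b' hi'] at hx
  apply coeff_injective
  ext j
  by_cases h1 : i' = i
  · subst h1
    rw [hb, hb', h]
  · by_cases h2 : i' = i + 1
    · subst h2
      have e1 := hx i
      have e2 := hx (i + 1)
      have e3 := hx (i + 2)
      have e4 := hx (j + 2)
      have e5 := hx j
      simp at e1 e2 e3
      rcases lt_trichotomy j i with hj | rfl | hj
      · simpa [hj, show j < i + 1 by omega] using e5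
      · omega
      · simpa [show ¬ j + 2 < i by omega, show j + 2 ≠ i by omega, show j + 2 ≠ i + 1 by omega,
          show ¬ j + 2 < i + 1 by omega, show j + 2 ≠ i + 1 + 1 by omega, show j ≠ i by omega,
          show ¬ j + 1 < i by omega]
          using e4
    · have e1 := hx i'
      have e2 := hx (i' + 1)
      have e3 := hJ (i' - 2)
      have : i' - 2 + 1 = i' - 1 := by omega
      rw [this] at e3
      simp [show ¬ i' < i by omega, h1, h2, show ¬ i' + 1 < i by omega,
        show i' + 1 ≠ i by omega] at e1 e2
      omega

theorem IsInsertion.eq_of_eq {b b' : Mono n} {J t t' : ℕ}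
    (hJ : ∀ j, b.coeff j + b.coeff (j + 1) < J) (hJ' : ∀ j, b'.coeff j + b'.coeff (j + 1) < J)
    {a : Mono (n + 2)} (h : IsInsertion b J t a) (h' : IsInsertion b' J t' a) :
    b = b' ∧ t = t' := by
  have hb : b = b' := by
    obtain ⟨i, x, y, hi, hxy, -, -, -, h1⟩ := h
    obtain ⟨i', x', y', hi', hxy', -, -, -, h2⟩ := h'
    rcases le_total i i' with hle | hle
    · exact insertPair_left_eq hle hi' (by rwa [hxy]) (by omega) (h1.symm.trans h2)
    · exact (insertPair_left_eq hle hi (by rwa [hxy']) (by omega) (h2.symm.trans h1)).symm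
  subst hb
  have h1 := h.weight_eq
  have h2 := h'.weight_eq
  exact ⟨rfl, by omega⟩

theorem IsInsertion.hasDegrees {b : Mono n} {t : ℕ} {a : Mono (n + 2)} {d : ℕ → ℕ}
    (hb : HasDegrees n b fun r => d (r + 1))
    (h : IsInsertion b (∑ r ∈ Finset.range (n / 2 + 2), d r) t a) : HasDegrees (n + 2) a d := by
  obtain ⟨i, x, y, hi, hxy, hx, hy, -, rfl⟩ := h
  have hJ : ∀ j, b.coeff j + b.coeff (j + 1) ≤ x + y := fun j => by
    rw [hxy, Finset.sum_range_succ']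
    exact (hb.pair_le j).trans (Nat.le_add_right _ _)
  refine ((IsInsertion.isMaxPair hJ hi hx hy).hasDegrees_iff
    (b.isDeletion_insertPair hi x y)).2 ⟨?_, hb⟩
  simp [coeff_insertPair b hi, hxy]

end Mono

theorem HasDegrees.exists_isInsertion {n : ℕ} {a : Mono (n + 2)} {d : ℕ → ℕ}
    (h : HasDegrees (n + 2) a d) :
    ∃ (b : Mono n) (t : ℕ), HasDegrees n b (fun r => d (r + 1)) ∧
      t + 2 * b.degree ≤ (n + 2) * ∑ r ∈ Finset.range (n / 2 + 2), d r ∧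
      b.IsInsertion (∑ r ∈ Finset.range (n / 2 + 2), d r) t a := by
  obtain ⟨i, hi⟩ := exists_isMaxPair a
  obtain ⟨b, hb⟩ := exists_isDeletion hi.1 a
  obtain ⟨hs, hd⟩ := (hi.hasDegrees_iff hb).1 h
  rw [hs]
  have hJ := hi.pair_le hb
  have hx : b.coeff i ≤ a.coeff i := by
    have := hi.2 (i + 1)
    rw [hb.coeff_of_le le_rfl]
    simp only [add_assoc, Nat.reduceAdd] at *
    omega
  have hy : ∀ j, j + 1 = i → b.coeff j ≤ a.coeff (i + 1) := by
    rintro j rfl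
    have := hi.2 j
    rw [hb.coeff_of_lt (by omega)]
    omega
  have hmono := Mono.breakpoint_mono hJ
  have hle : a.coeff i + 2 * b.prefixSum i ≤ (i + 1) * (a.coeff i + a.coeff (i + 1)) := by
    have h1 := hmono (Nat.zero_le i)
    rw [Mono.breakpoint_zero] at h1
    simp only [Mono.breakpoint] at h1
    rcases i with _ | i
    · simp [Mono.prefixSum_zero]
    · have h2 := hy i rfl
      have h3 := b.prefixSum_succ i
      simp only [Nat.add_sub_cancel] at h1
      zify at *
      linarith
  obtain ⟨t, ht⟩ := Nat.exists_eq_add_of_le' hle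
  rw [← add_assoc] at ht
  refine ⟨b, t, hd, ?_, i, _, _, hi.1, rfl, hx, hy, ht.symm, Mono.eq_insertPair hb hi.1⟩
  have h1 := (Mono.IsInsertion.mem_breakpoint rfl hx hy ht.symm).2
  have h2 := h1.trans (hmono (show i + 1 ≤ n + 2 by have := hi.1; omega))
  rw [Mono.breakpoint_last] at h2
  push_cast at h2
  zify
  linarith

/-! ### Symmetric chain decompositions of unions and grids -/

section ChainDecomposition

variable {α : Type*} [PartialOrder α] {wt : α → ℤ}

theorem isSymmetricSaturatedChain_of_seq {x : ℕ → α} {l : ℕ} (h : ∀ i < l, x i ⋖ x (i + 1))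
    (hw : wt (x 0) + wt (x l) = 0) : IsSymmetricSaturatedChain wt {a | ∃ i ≤ l, x i = a} := by
  refine ⟨l, fun i => x i, fun i => h i i.isLt, ?_, by simpa using hw⟩
  ext a
  constructor
  · rintro ⟨i, hi, rfl⟩
    exact ⟨⟨i, by omega⟩, rfl⟩
  · rintro ⟨i, rfl⟩
    exact ⟨i, by omega, rfl⟩

theorem IsSymmetricSaturatedChain.exists_seq {C : Set α} (h : IsSymmetricSaturatedChain wt C) :
    ∃ (l : ℕ) (x : ℕ → α), (∀ i < l, x i ⋖ x (i + 1)) ∧ wt (x 0) + wt (x l) = 0 ∧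
      C = {a | ∃ i ≤ l, x i = a} := by
  obtain ⟨l, x, hx, rfl, hw⟩ := h
  have e : ∀ i (hi : i ≤ l), x ⟨min i l, by omega⟩ = x ⟨i, by omega⟩ := fun i hi => by
    congr 2
    omega
  refine ⟨l, fun i => x ⟨min i l, by omega⟩, fun i hi => ?_, ?_, ?_⟩
  · simp only
    rw [e i hi.le, e (i + 1) hi]
    exact hx ⟨i, hi⟩
  · simp only
    rw [e 0 (Nat.zero_le l), e l le_rfl]
    exact hw
  · ext a
    constructor
    · rintro ⟨i, rfl⟩
      exact ⟨i, by omega, e i (by omega)⟩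
    · rintro ⟨i, hi, rfl⟩
      exact ⟨_, rfl⟩

theorem IsSymmetricSaturatedChain.hasSymmetricChainDecomposition {C : Set α}
    (h : IsSymmetricSaturatedChain wt C) : HasSymmetricChainDecomposition wt C :=
  ⟨{C}, by simpa using h, Set.pairwiseDisjoint_singleton _ _, Set.sUnion_singleton C⟩

theorem HasSymmetricChainDecomposition.iUnion {ι : Type*} {S : ι → Set α}
    (h : ∀ i, HasSymmetricChainDecomposition wt (S i))
    (hd : Pairwise fun i j => Disjoint (S i) (S j)) :
    HasSymmetricChainDecomposition wt (⋃ i, S i) := by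
  choose 𝒞 h1 h2 h3 using h
  refine ⟨⋃ i, 𝒞 i, ?_, ?_, ?_⟩
  · intro C hC
    obtain ⟨i, hi⟩ := Set.mem_iUnion.1 hC
    exact h1 i C hi
  · intro C hC C' hC' hne
    obtain ⟨i, hi⟩ := Set.mem_iUnion.1 hC
    obtain ⟨j, hj⟩ := Set.mem_iUnion.1 hC'
    by_cases hij : i = j
    · subst hij
      exact h2 i hi hj hne
    · refine (hd hij).mono ?_ ?_
      · rw [← h3 i]; exact Set.subset_sUnion_of_mem hi
      · rw [← h3 j]; exact Set.subset_sUnion_of_mem hj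
  · rw [Set.sUnion_iUnion]
    exact Set.iUnion_congr h3

theorem hasSymmetricChainDecomposition_empty :
    HasSymmetricChainDecomposition wt (∅ : Set α) :=
  ⟨∅, by simp, Set.pairwiseDisjoint_empty, Set.sUnion_empty⟩

theorem HasSymmetricChainDecomposition.union {S T : Set α}
    (hS : HasSymmetricChainDecomposition wt S) (hT : HasSymmetricChainDecomposition wt T)
    (hd : Disjoint S T) : HasSymmetricChainDecomposition wt (S ∪ T) := by
  rw [Set.union_eq_iUnion]
  refine .iUnion (Bool.forall_bool.2 ⟨hT, hS⟩) ?_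
  rintro (_ | _) (_ | _) h
  · exact absurd rfl h
  · exact hd.symm
  · exact hd
  · exact absurd rfl h

theorem hasSymmetricChainDecomposition_of_subsingleton {S : Set α} (h : S.Subsingleton)
    (hw : ∀ a ∈ S, wt a = 0) : HasSymmetricChainDecomposition wt S := by
  rcases h.eq_empty_or_singleton with rfl | ⟨a, rfl⟩
  · exact hasSymmetricChainDecomposition_empty
  · have ha := hw a rfl
    have := isSymmetricSaturatedChain_of_seq (wt := wt) (x := fun _ => a) (l := 0) (by simp)
      (by simp [ha])
    convert this.hasSymmetricChainDecomposition using 1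
    ext b
    simp [eq_comm]

/-- A path in a grid which consists of a part of the row `t₀` and a part of the column `s₁`. -/
theorem isSymmetricSaturatedChain_hook {f : ℕ → ℕ → α} {s₀ s₁ t₀ t₁ : ℕ} (hs : s₀ ≤ s₁)
    (ht : t₀ ≤ t₁) (hrow : ∀ s, s₀ ≤ s → s < s₁ → f s t₀ ⋖ f (s + 1) t₀)
    (hcol : ∀ t, t₀ ≤ t → t < t₁ → f s₁ t ⋖ f s₁ (t + 1))
    (hw : wt (f s₀ t₀) + wt (f s₁ t₁) = 0) :
    IsSymmetricSaturatedChain wt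
      {a | ∃ s t, (t = t₀ ∧ s₀ ≤ s ∧ s ≤ s₁ ∨ s = s₁ ∧ t₀ ≤ t ∧ t ≤ t₁) ∧ f s t = a} := by
  let x : ℕ → α := fun i => f (min (s₀ + i) s₁) (t₀ + (i - (s₁ - s₀)))
  have hx1 : ∀ i, i ≤ s₁ - s₀ → x i = f (s₀ + i) t₀ := fun i hi => by
    simp only [x]
    congr 1 <;> omega
  have hx2 : ∀ i, x (s₁ - s₀ + i) = f s₁ (t₀ + i) := fun i => by
    simp only [x]
    congr 1 <;> omega
  have key := isSymmetricSaturatedChain_of_seq (wt := wt) (x := x) (l := s₁ - s₀ + (t₁ - t₀))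
    (fun i hi => ?_) ?_
  · convert key using 1
    ext a
    constructor
    · rintro ⟨s, t, ⟨rfl, h1, h2⟩ | ⟨rfl, h1, h2⟩, rfl⟩
      · exact ⟨s - s₀, by omega, by rw [hx1 _ (by omega)]; congr 1; omega⟩
      · exact ⟨s - s₀ + (t - t₀), by omega, by rw [hx2]; congr 1; omega⟩
    · rintro ⟨i, hi, rfl⟩
      rcases le_or_gt i (s₁ - s₀) with h | h
      · exact ⟨s₀ + i, t₀, Or.inl ⟨rfl, by omega, by omega⟩, (hx1 i h).symm⟩
      · obtain ⟨i, rfl⟩ := Nat.exists_eq_add_of_le h.le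
        exact ⟨s₁, t₀ + i, Or.inr ⟨rfl, by omega, by omega⟩, (hx2 i).symm⟩
  · rcases lt_or_ge i (s₁ - s₀) with h | h
    · rw [hx1 i h.le, hx1 (i + 1) h]
      exact hrow _ (by omega) (by omega)
    · obtain ⟨i, rfl⟩ := Nat.exists_eq_add_of_le h
      rw [add_assoc, hx2, hx2]
      exact hcol _ (by omega) (by omega)
  · rw [hx1 0 (Nat.zero_le _), hx2, Nat.add_sub_cancel' ht]
    exact hw

/-- The boundary of the grid is the disjoint union of two symmetric hooks, and removing it leaves a
smaller grid with the same center. The `i`-th layer uses only the rows `i` and `N - i` with `2 i <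
l`, so `i ≤ D`. -/
theorem hasSymmetricChainDecomposition_grid {f : ℕ → ℕ → α} {l N D : ℕ}
    (hinj : ∀ s t s' t', s ≤ l → t ≤ N → s' ≤ l → t' ≤ N → f s t = f s' t' → s = s' ∧ t = t')
    (hcol : ∀ s t, s ≤ l → t < N → f s t ⋖ f s (t + 1))
    (hrow : ∀ s t, s < l → t ≤ N → (t ≤ D ∨ N ≤ t + D) → f s t ⋖ f (s + 1) t)
    (hwt : ∀ s t, s ≤ l → t ≤ N → wt (f s t) = l + N - 2 * (s + t))
    (hD : l ≤ 2 * D + 1) (hN : l ≤ N) :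
    HasSymmetricChainDecomposition wt {a | ∃ s t, s ≤ l ∧ t ≤ N ∧ f s t = a} := by
  -- `i` counts the layers removed so far; `k` only bounds the recursion.
  have key : ∀ k i, l < 2 * i + k → HasSymmetricChainDecomposition wt
      {a | ∃ s t, (i ≤ s ∧ s + i ≤ l ∧ i ≤ t ∧ t + i ≤ N) ∧ f s t = a} := by
    intro k
    induction k with
    | zero =>
      intro i hi
      convert hasSymmetricChainDecomposition_empty (wt := wt) using 1
      rw [Set.eq_empty_iff_forall_notMem]
      rintro a ⟨s, t, h, -⟩
      omega
    | succ k ih =>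
      intro i hi
      rcases lt_trichotomy l (2 * i) with hl | hl | hl
      · exact ih i (by omega)
      -- Only the column `s = i` is left, and it is a single symmetric chain.
      · have := isSymmetricSaturatedChain_hook (wt := wt) (f := f) (s₀ := i) (s₁ := i) (t₀ := i)
          (t₁ := N - i) le_rfl (by omega) (fun s h1 h2 => by omega)
          (fun t h1 h2 => hcol i t (by omega) (by omega))
          (by rw [hwt _ _ (by omega) (by omega), hwt _ _ (by omega) (by omega)]; omega)
        convert this.hasSymmetricChainDecomposition using 1
        ext a
        constructor
        · rintro ⟨s, t, h, rfl⟩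
          exact ⟨s, t, by omega, rfl⟩
        · rintro ⟨s, t, h, rfl⟩
          exact ⟨s, t, by omega, rfl⟩
      · have h1 := isSymmetricSaturatedChain_hook (wt := wt) (f := f) (s₀ := i) (s₁ := l - i)
          (t₀ := i) (t₁ := N - i) (by omega) (by omega)
          (fun s h1 h2 => hrow s i (by omega) (by omega) (by omega))
          (fun t h1 h2 => hcol _ t (by omega) (by omega))
          (by rw [hwt _ _ (by omega) (by omega), hwt _ _ (by omega) (by omega)]; omega)
        have h2 := isSymmetricSaturatedChain_hook (wt := wt) (f := fun t s => f s t) (s₀ := i + 1)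
          (s₁ := N - i) (t₀ := i) (t₁ := l - i - 1) (by omega) (by omega)
          (fun t h1 h2 => hcol i t (by omega) (by omega))
          (fun s h1 h2 => hrow s _ (by omega) (by omega) (by omega))
          (by rw [hwt _ _ (by omega) (by omega), hwt _ _ (by omega) (by omega)]; omega)
        have h3 := ih (i + 1) (by omega)
        have h4 := (h1.hasSymmetricChainDecomposition.union h2.hasSymmetricChainDecomposition
          (by
            rw [Set.disjoint_left]
            rintro _ ⟨s, t, h, rfl⟩ ⟨t', s', h', he⟩
            have := hinj s' t' s t (by omega) (by omega) (by omega) (by omega) he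
            omega)).union h3
          (by
            rw [Set.disjoint_left]
            rintro _ (⟨s, t, h, rfl⟩ | ⟨t, s, h, rfl⟩) ⟨s', t', h', he⟩
            · have := hinj s' t' s t (by omega) (by omega) (by omega) (by omega) he
              omega
            · have := hinj s' t' s t (by omega) (by omega) (by omega) (by omega) he
              omega)
        convert h4 using 1
        ext a
        constructor
        · rintro ⟨s, t, h, rfl⟩
          by_cases c1 : t = i ∨ s = l - i
          · exact Or.inl (Or.inl ⟨s, t, by omega, rfl⟩)
          · by_cases c2 : s = i ∨ t = N - i
            · exact Or.inl (Or.inr ⟨t, s, by omega, rfl⟩)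
            · exact Or.inr ⟨s, t, by omega, rfl⟩
        · rintro ((⟨s, t, h, rfl⟩ | ⟨t, s, h, rfl⟩) | ⟨s, t, h, rfl⟩)
          · exact ⟨s, t, by omega, rfl⟩
          · exact ⟨s, t, by omega, rfl⟩
          · exact ⟨s, t, by omega, rfl⟩
  convert key (l + 1) 0 (by omega) using 1
  ext a
  simp [and_assoc]

end ChainDecomposition

/-! ### Weight bound, and the case of positive `d_0` -/

theorem card_mul_le_sum_of_sparse (S : Finset ℕ) :
    (∀ i ∈ S, i + 1 ∉ S) → S.card * (S.card - 1) ≤ ∑ i ∈ S, i := by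
  induction S using Finset.induction_on_max with
  | empty => simp
  | insert a s hs ih =>
    intro h
    have ha : a ∉ s := fun h' => lt_irrefl _ (hs a h')
    have ih' := ih fun i hi hi' =>
      h i (Finset.mem_insert_of_mem hi) (Finset.mem_insert_of_mem hi')
    have hc : 2 * s.card ≤ a := by
      rcases s.eq_empty_or_nonempty with rfl | ⟨x, hx⟩
      · simp
      · have hle : ∀ i ∈ s, i + 1 < a := fun i hi => by
          have h1 := hs i hi
          have h2 : i + 1 ≠ a := fun h' =>
            h i (Finset.mem_insert_of_mem hi) (h' ▸ Finset.mem_insert_self _ _)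
          omega
        have h1 := hle x hx
        have : IsSparse (a - 2) s := ⟨fun i hi => by have := hle i hi; omega, fun i hi hi' =>
          h i (Finset.mem_insert_of_mem hi) (Finset.mem_insert_of_mem hi')⟩
        have := this.card_le
        omega
    rw [Finset.sum_insert ha, Finset.card_insert_of_notMem ha, Nat.add_sub_cancel]
    have h3 : (s.card + 1) * s.card = s.card * (s.card - 1) + 2 * s.card := by
      rcases s.card with _ | c
      · simp
      · simp; ring
    omega

/-- A sparse set of size `r + 1` has element sum at least `0 + 2 + ⋯ + 2r`, so a factor of index `r`
has weight at most `(n - 2r)(r + 1)`. -/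
theorem HasFactorization.weight_le {n : ℕ} {μ : Mono n} {e : ℕ → ℕ}
    (h : HasFactorization n μ e) :
    μ.weight ≤ ∑ r ∈ Finset.range (n / 2 + 1), (e r : ℤ) * ((n : ℤ) - 2 * r) * (r + 1) := by
  obtain ⟨S, hS, hc⟩ := h.exists_cover
  have h1 : μ.weight = ∑ p, ∑ j ∈ S p, ((n : ℤ) - 2 * j) := by
    rw [Mono.weight_eq_sum_range]
    have : ∀ j, ((μ.coeff j : ℕ) : ℤ) * ((n : ℤ) - 2 * j) =
        ∑ p, if j ∈ S p then ((n : ℤ) - 2 * j) else 0 := by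
      intro j
      rw [← hS.2, ← Finset.sum_filter, Finset.sum_const, nsmul_eq_mul]
    simp_rw [this]
    rw [Finset.sum_comm]
    refine Finset.sum_congr rfl fun p _ => ?_
    rw [← Finset.sum_filter]
    refine Finset.sum_congr ?_ fun _ _ => rfl
    ext j
    have := (hS.1 p).1 j
    simp only [Finset.mem_filter, Finset.mem_range]
    exact ⟨fun h => h.2, fun h => ⟨by have := this h; omega, h⟩⟩
  have h2 : ∀ p, ∑ j ∈ S p, ((n : ℤ) - 2 * j) ≤ ((n : ℤ) - 2 * (p.1 : ℕ)) * ((p.1 : ℕ) + 1) := by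
    intro p
    have h3 := card_mul_le_sum_of_sparse (S p) (hS.1 p).2
    rw [hc, Nat.add_sub_cancel] at h3
    rw [Finset.sum_sub_distrib, Finset.sum_const, hc, ← Finset.mul_sum, nsmul_eq_mul]
    zify at h3
    push_cast
    linarith
  rw [h1]
  refine (Finset.sum_le_sum fun p _ => h2 p).trans_eq ?_
  rw [Fintype.sum_sigma, Finset.sum_range]
  refine Finset.sum_congr rfl fun r _ => ?_
  simp [mul_assoc]

/-- Each symmetric chain of the smaller set spans a grid of insertions. Positivity of `d 0` makes
every pair sum of `b` strictly less than `J`, which is what makes the grids injective and mutually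
disjoint. -/
theorem hasSymmetricChainDecomposition_Q_of_pos {n : ℕ} {d : ℕ → ℕ} (hd0 : 0 < d 0)
    (hQ : HasSymmetricChainDecomposition Mono.weight (Q n fun j => d (j + 1)))
    (hW : ∑ r ∈ Finset.range (n / 2 + 1), (d (r + 1) : ℤ) * ((n : ℤ) - 2 * r) * (r + 1) ≤
      1 + 2 * d 0) :
    HasSymmetricChainDecomposition Mono.weight (Q (n + 2) d) := by
  obtain ⟨𝒞, hC, hdisj, hun⟩ := hQ
  set J := ∑ r ∈ Finset.range (n / 2 + 2), d r with hJ
  have hJ' : J = ∑ r ∈ Finset.range (n / 2 + 1), d (r + 1) + d 0 := Finset.sum_range_succ' _ _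
  set m := ∑ r ∈ Finset.range (n / 2 + 1), (r + 1) * d (r + 1) with hm
  have hdeg : ∀ b ∈ Q n fun j => d (j + 1), b.degree = m := fun b hb => hb.1.degree_eq
  have hmJ : 2 * m + (n + 2) * d 0 ≤ (n + 2) * J := by
    have : 2 * m ≤ (n + 2) * ∑ r ∈ Finset.range (n / 2 + 1), d (r + 1) := by
      rw [hm, Finset.mul_sum, Finset.mul_sum]
      refine Finset.sum_le_sum fun r hr => ?_
      rw [← mul_assoc]
      have := Finset.mem_range.1 hr
      exact Nat.mul_le_mul_right _ (by omega)
    rw [hJ', Nat.mul_add]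
    omega
  obtain ⟨N, hN⟩ : ∃ N, N + 2 * m = (n + 2) * J := ⟨(n + 2) * J - 2 * m, by omega⟩
  have hpair : ∀ b ∈ Q n fun j => d (j + 1), ∀ j, b.coeff j + b.coeff (j + 1) + d 0 ≤ J :=
    fun b hb j => by
      have := HasDegrees.pair_le hb j
      omega
  have hex : ∀ (b : Mono n) (t : ℕ), ∃ a, b ∈ Q n (fun j => d (j + 1)) → t ≤ N →
      b.IsInsertion J t a := by
    intro b t
    by_cases h : b ∈ Q n (fun j => d (j + 1)) ∧ t ≤ N
    · obtain ⟨a, ha⟩ := Mono.exists_isInsertion (b := b) (J := J) (t := t)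
        (by rw [hdeg b h.1]; omega)
      exact ⟨a, fun _ _ => ha⟩
    -- An arbitrary value outside the relevant range.
    · exact ⟨Mono.ofCoeff _ 0, fun h1 h2 => absurd ⟨h1, h2⟩ h⟩
  choose F hF using hex
  have hFinj : ∀ b b' t t', b ∈ Q n (fun j => d (j + 1)) → b' ∈ Q n (fun j => d (j + 1)) →
      t ≤ N → t' ≤ N → F b t = F b' t' → b = b' ∧ t = t' := by
    intro b b' t t' hb hb' ht ht' he
    have h1 := hF b t hb ht
    rw [he] at h1
    exact h1.eq_of_eq (fun j => by have := hpair b hb j; omega)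
      (fun j => by have := hpair b' hb' j; omega) (hF b' t' hb' ht')
  have hCQ : ∀ C ∈ 𝒞, ∀ b ∈ C, b ∈ Q n fun j => d (j + 1) := fun C hC b hb =>
    hun ▸ Set.mem_sUnion_of_mem hb hC
  have hQun : Q (n + 2) d = ⋃ C : 𝒞, {a | ∃ b ∈ (C : Set (Mono n)), ∃ t ≤ N, F b t = a} := by
    ext a
    rw [Set.mem_iUnion]
    constructor
    · intro ha
      obtain ⟨b, t, hb, ht, hins⟩ := HasDegrees.exists_isInsertion ha
      have hb' : b ∈ ⋃₀ 𝒞 := hun ▸ hb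
      obtain ⟨C, hC, hbC⟩ := hb'
      have htN : t ≤ N := by
        have := hdeg b hb
        rw [this, ← hJ] at ht
        omega
      exact ⟨⟨C, hC⟩, b, hbC, t, htN, (hF b t hb htN).unique
        (fun j => (Nat.le_add_right _ _).trans (hpair b hb j)) hins⟩
    · rintro ⟨⟨C, hC⟩, b, hb, t, ht, rfl⟩
      exact (hF b t (hCQ C hC b hb) ht).hasDegrees (hCQ C hC b hb)
  rw [hQun]
  refine .iUnion ?_ ?_
  · rintro ⟨C, hCC⟩
    have hCQ' := hCQ C hCC
    obtain ⟨l, x, hx, hxw, rfl⟩ := (hC C hCC).exists_seq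
    have hxQ : ∀ s ≤ l, x s ∈ Q n fun j => d (j + 1) := fun s hs => hCQ' _ ⟨s, hs, rfl⟩
    have hxw' : ∀ s ≤ l, (x s).weight = (x 0).weight - 2 * s := by
      intro s
      induction s with
      | zero => simp
      | succ s ih =>
        intro hs
        have h1 := Mono.weight_of_covBy (hx s hs)
        have h2 := ih (by omega)
        push_cast
        linarith
    have hl : (x 0).weight = l := by
      have := hxw' l le_rfl
      linarith
    have hlW : (l : ℤ) ≤ 1 + 2 * d 0 := by
      have h1 := (hxQ 0 (Nat.zero_le l)).1.weight_le
      rw [hl] at h1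
      exact h1.trans hW
    -- For `n ≥ 1`, `N ≥ (n + 2) d_0 ≥ 3 d_0 ≥ 1 + 2 d_0`; for `n = 0` all weights vanish and `l =
    -- 0`.
    have hlN : l ≤ N := by
      rcases Nat.eq_zero_or_pos n with rfl | hn
      · have h1 := (hxQ 0 (Nat.zero_le l)).1.weight_le
        rw [hl] at h1
        simp at h1
        omega
      · have : 3 * d 0 ≤ (n + 2) * d 0 := Nat.mul_le_mul_right _ (by omega)
        omega
    have hgrid := hasSymmetricChainDecomposition_grid (wt := Mono.weight)
      (f := fun s t => F (x s) t) (l := l) (N := N) (D := d 0) ?_ ?_ ?_ ?_ (by omega) hlN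
    · convert hgrid using 1
      ext a
      constructor
      · rintro ⟨_, ⟨s, hs, rfl⟩, t, ht, rfl⟩
        exact ⟨s, t, hs, ht, rfl⟩
      · rintro ⟨s, t, hs, ht, rfl⟩
        exact ⟨_, ⟨s, hs, rfl⟩, t, ht, rfl⟩
    · intro s t s' t' hs ht hs' ht' he
      obtain ⟨h1, h2⟩ := hFinj _ _ _ _ (hxQ s hs) (hxQ s' hs') ht ht' he
      have h3 := hxw' s hs
      have h4 := hxw' s' hs'
      rw [h1] at h3
      omega
    · intro s t hs ht
      exact (hF _ _ (hxQ s hs) ht.le).covBy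
        (fun j => (Nat.le_add_right _ _).trans (hpair _ (hxQ s hs) j)) (hF _ _ (hxQ s hs) ht)
    · intro s t hs ht htD
      refine Mono.IsInsertion.covBy_of_covBy (hx s hs) (hpair _ (hxQ s hs.le))
        (hpair _ (hxQ (s + 1) hs)) ?_ (hF _ _ (hxQ s hs.le) ht) (hF _ _ (hxQ (s + 1) hs) ht)
      rw [hdeg _ (hxQ s hs.le)]
      rcases htD with h | h
      · exact Or.inl h
      · exact Or.inr ⟨N - t, by omega, by omega⟩
    · intro s t hs ht
      rw [(hF _ _ (hxQ s hs) ht).weight_eq, hxw' s hs, hl, hdeg _ (hxQ s hs)]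
      zify at hN
      linarith
  · rintro ⟨C, hCC⟩ ⟨C', hCC'⟩ hne
    rw [Set.disjoint_left]
    rintro _ ⟨b, hb, t, ht, rfl⟩ ⟨b', hb', t', ht', he⟩
    obtain ⟨rfl, -⟩ := hFinj _ _ _ _ (hCQ C' hCC' b' hb') (hCQ C hCC b hb) ht' ht he
    exact Set.disjoint_left.1 (hdisj hCC hCC' fun h => hne (Subtype.ext h)) hb hb'

/-! ### The cases `d_0 = 0` and `n ≤ 1` -/

theorem prefixSum_eq_of_degree_eq {m c : ℕ} {a : Mono (2 * m)} (hd : a.degree = (m + 1) * c)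
    (hJ : ∀ j, a.coeff j + a.coeff (j + 1) ≤ c) {j : ℕ} (hj : j ≤ m) :
    a.prefixSum (2 * j + 1) = (j + 1) * c ∧ (j < m → a.prefixSum (2 * j + 2) = (j + 1) * c) := by
  have h1 : ∀ j, a.prefixSum (2 * j) ≤ j * c := by
    intro j
    induction j with
    | zero => simp [Mono.prefixSum_zero]
    | succ j ih =>
      rw [Nat.mul_succ, Mono.prefixSum_succ, Mono.prefixSum_succ,
        show (j + 1) * c = j * c + c by ring]
      have := hJ (2 * j)
      omega
  have h2 : ∀ k j, j + k = m → (j + 1) * c ≤ a.prefixSum (2 * j + 1) := by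
    intro k
    induction k with
    | zero =>
      intro j hj
      obtain rfl : j = m := hj
      rw [Mono.prefixSum_of_lt _ (by omega), hd]
    | succ k ih =>
      intro j hj
      have h3 := ih (j + 1) (by omega)
      have h4 := hJ (2 * j + 1)
      rw [show (j + 1 + 1) * c = (j + 1) * c + c by ring, show 2 * (j + 1) + 1 = 2 * j + 1 + 1 + 1 by ring, Mono.prefixSum_succ,
        Mono.prefixSum_succ] at h3
      simp only [add_assoc, Nat.reduceAdd] at h3 h4 ⊢
      omega
  have h3 := h1 (j + 1)
  have h4 := h2 (m - j) j (by omega)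
  have h5 := a.prefixSum_mono (Nat.le_succ (2 * j + 1))
  simp only [Nat.succ_eq_add_one, Nat.mul_succ, add_assoc, Nat.reduceAdd] at *
  rcases Nat.eq_or_lt_of_le hj with rfl | hj
  · refine ⟨?_, fun h => absurd h (lt_irrefl _)⟩
    rw [Mono.prefixSum_of_lt _ (by omega), hd]
  · exact ⟨by omega, fun _ => by omega⟩

/-- Splitting the exponents into adjacent pairs from either end squeezes the prefix sums, so the
only possible exponent vector is `(c, 0, c, …, 0, c)`, of weight zero. -/
theorem hasSymmetricChainDecomposition_of_degree_eq {m c : ℕ} {S : Set (Mono (2 * m))}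
    (h : ∀ a ∈ S, a.degree = (m + 1) * c ∧ ∀ j, a.coeff j + a.coeff (j + 1) ≤ c) :
    HasSymmetricChainDecomposition Mono.weight S := by
  refine hasSymmetricChainDecomposition_of_subsingleton ?_ ?_
  · intro a ha b hb
    apply Mono.prefixSum_injective
    ext j
    by_cases hj : 2 * m < j
    · rw [Mono.prefixSum_of_lt _ hj, Mono.prefixSum_of_lt _ hj, (h a ha).1, (h b hb).1]
    · obtain ⟨i, rfl | rfl⟩ := j.even_or_odd'
      · rcases i with _ | i
        · simp [Mono.prefixSum_zero]
        · rw [Nat.mul_succ, (prefixSum_eq_of_degree_eq (h a ha).1 (h a ha).2 (by omega)).2 (by omega),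
            (prefixSum_eq_of_degree_eq (h b hb).1 (h b hb).2 (by omega)).2 (by omega)]
      · rw [(prefixSum_eq_of_degree_eq (h a ha).1 (h a ha).2 (by omega)).1,
          (prefixSum_eq_of_degree_eq (h b hb).1 (h b hb).2 (by omega)).1]
  · intro a ha
    obtain ⟨hd, hJ⟩ := h a ha
    have key : ∀ j ≤ m, ∑ i ∈ Finset.range (2 * j + 1), a.prefixSum i = j * (j + 1) * c := by
      intro j
      induction j with
      | zero => simp [Mono.prefixSum_zero]
      | succ j ih =>
        intro hj
        obtain ⟨h1, h2⟩ := prefixSum_eq_of_degree_eq hd hJ (show j ≤ m by omega)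
        rw [show 2 * (j + 1) + 1 = 2 * j + 1 + 1 + 1 by ring, Finset.sum_range_succ,
          Finset.sum_range_succ, ih (by omega), h1, h2 (by omega)]
        ring
    have h1 := key m le_rfl
    zify at h1
    rw [Mono.weight_eq_prefixSum, h1, hd]
    push_cast
    ring

theorem hasSymmetricChainDecomposition_Q_three {d : ℕ → ℕ} (h0 : d 0 = 0) (h1 : d 1 = 1) :
    HasSymmetricChainDecomposition Mono.weight (Q 3 d) := by
  let c : ℕ → ℕ → ℕ := fun i j =>
    if j = 0 then (if i ≤ 1 then 1 else 0) else if j = 1 then (if i = 2 then 1 else 0)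
    else if j = 2 then (if i = 0 then 1 else 0) else if j = 3 then (if 1 ≤ i then 1 else 0) else 0
  -- The chain `z_0 z_2`, `z_0 z_3`, `z_1 z_3`.
  let x : ℕ → Mono 3 := fun i => Mono.ofCoeff 3 (c i)
  have hx : ∀ i, (x i).coeff = c i := fun i => Mono.coeff_ofCoeff fun j hj => by
    simp only [c]
    rw [if_neg (by omega), if_neg (by omega), if_neg (by omega), if_neg (by omega)]
  have hmem : ∀ a : Mono 3, a ∈ Q 3 d ↔
      a.degree = 2 ∧ ∀ j, a.coeff j + a.coeff (j + 1) ≤ 1 := by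
    intro a
    constructor
    · intro h
      refine ⟨?_, fun j => ?_⟩
      · rw [h.1.degree_eq]
        simp [Finset.sum_range_succ, h0, h1]
      · simpa [Finset.sum_range_succ, h0, h1] using HasDegrees.pair_le h j
    · rintro ⟨h2, h3⟩
      obtain ⟨D, hD, -, j, hj⟩ := exists_hasDegrees a
      have h4 := h3 j
      have h5 := hD.1.degree_eq
      simp [Finset.sum_range_succ] at hj h5
      refine hD.congr fun r hr => ?_
      obtain rfl | rfl : r = 0 ∨ r = 1 := by omega
      · omega
      · omega
  have hdeg : ∀ a : Mono 3, a.degree = a.coeff 0 + a.coeff 1 + a.coeff 2 + a.coeff 3 := fun a => by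
    simp [Mono.degree_eq_sum_range, Finset.sum_range_succ]
  have hxd : ∀ i ≤ 2, (x i).degree = 2 := fun i hi => by
    rw [hdeg, hx]
    interval_cases i <;> simp [c]
  have hxw : ∀ i ≤ 2, (x i).weight = 2 - 2 * i := fun i hi => by
    rw [Mono.weight_eq_sum_range, hx]
    interval_cases i <;> simp [c, Finset.sum_range_succ]
  have hcov : ∀ i < 2, x i ⋖ x (i + 1) := fun i hi => by
    refine Mono.covBy_of_le_of_weight (Mono.le_iff_prefixSum.2 ⟨?_, fun j => ?_⟩) ?_
    · rw [hxd _ hi.le, hxd _ hi]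
    · by_cases hj : 3 < j
      · rw [Mono.prefixSum_of_lt _ hj, Mono.prefixSum_of_lt _ hj, hxd _ hi.le, hxd _ hi]
      · rw [Mono.prefixSum, Mono.prefixSum, hx, hx]
        interval_cases i <;> interval_cases j <;> simp [c, Finset.sum_range_succ]
    · rw [hxw _ hi.le, hxw _ hi]
      push_cast
      ring
  have key := isSymmetricSaturatedChain_of_seq (wt := Mono.weight) hcov
    (by rw [hxw _ (by omega), hxw _ le_rfl]; norm_num)
  convert key.hasSymmetricChainDecomposition using 1
  ext a
  rw [hmem]
  constructor
  · rintro ⟨h2, h3⟩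
    rw [hdeg] at h2
    have e0 := h3 0
    have e1 := h3 1
    have e2 := h3 2
    simp only [Nat.reduceAdd] at e0 e1 e2
    refine ⟨a.coeff 3 + a.coeff 1, by omega, Mono.coeff_injective (funext fun j => ?_)⟩
    rw [hx]
    simp only [c]
    split_ifs with c0 c1 c2 c3 c4 c5 c6 c7
    all_goals first | subst_vars; omega | exact (a.coeff_of_lt (by omega)).symm
  · rintro ⟨i, hi, rfl⟩
    refine ⟨hxd i hi, fun j => ?_⟩
    rw [hx]
    rcases lt_or_ge j 4 with hj | hj
    · interval_cases i <;> interval_cases j <;> simp [c]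
    · simp only [c]
      rw [if_neg (by omega), if_neg (by omega), if_neg (by omega), if_neg (by omega),
        if_neg (by omega), if_neg (by omega), if_neg (by omega), if_neg (by omega)]
      omega

theorem hasSymmetricChainDecomposition_Q_of_zero {n : ℕ} {d : ℕ → ℕ} (hd0 : d 0 = 0)
    (hW : ∑ r ∈ Finset.range (n / 2 + 1), (d (r + 1) : ℤ) * ((n : ℤ) - 2 * r) * (r + 1) ≤ 1) :
    HasSymmetricChainDecomposition Mono.weight (Q (n + 2) d) := by
  have hnn : ∀ r ∈ Finset.range (n / 2 + 1),
      (0 : ℤ) ≤ (d (r + 1) : ℤ) * ((n : ℤ) - 2 * r) * (r + 1) := fun r hr => by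
    have := Finset.mem_range.1 hr
    have : (0 : ℤ) ≤ (n : ℤ) - 2 * r := by omega
    positivity
  -- A summand with `2 r = n` vanishes and leaves `d (r + 1)` free. A nonzero `d (r + 1)` with `2 r
  -- < n` contributes at least one, which forces `r = 0`, `n = 1` and `d 1 = 1`.
  by_cases hz : ∀ r, 2 * r < n → d (r + 1) = 0
  · obtain ⟨m, hm⟩ := n.even_or_odd'
    rcases hm with rfl | rfl
    · have hz' : ∀ r ∈ Finset.range (2 * m / 2 + 1), r ≠ m → d (r + 1) = 0 := fun r hr hne =>
        hz r (by have := Finset.mem_range.1 hr; omega)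
      refine hasSymmetricChainDecomposition_of_degree_eq (m := m + 1) (c := d (m + 1)) fun a ha => ?_
      have h2 : (2 * m + 2) / 2 + 1 = 2 * m / 2 + 1 + 1 := by omega
      refine ⟨?_, fun j => ?_⟩
      · refine ha.1.degree_eq.trans ?_
        rw [h2, Finset.sum_range_succ', hd0, mul_zero, add_zero, Finset.sum_eq_single m]
        · intro r hr hne
          rw [hz' r hr hne, mul_zero]
        · intro h
          simp at h
      · refine (HasDegrees.pair_le ha j).trans_eq ?_
        rw [h2, Finset.sum_range_succ', hd0, add_zero, Finset.sum_eq_single m hz']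
        intro h
        simp at h
    · have hdeg : ∀ a ∈ Q (2 * m + 1 + 2) d, a.degree = 0 := fun a ha => by
        rw [ha.1.degree_eq, Finset.sum_eq_zero]
        intro r hr
        have := Finset.mem_range.1 hr
        rcases r with _ | r
        · rw [hd0, mul_zero]
        · rw [hz r (by omega), mul_zero]
      have hp : ∀ a ∈ Q (2 * m + 1 + 2) d, ∀ j, a.prefixSum j = 0 := fun a ha j =>
        Nat.le_zero.1 ((a.prefixSum_le_degree j).trans_eq (hdeg a ha))
      refine hasSymmetricChainDecomposition_of_subsingleton (fun a ha b hb => ?_) fun a ha => ?_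
      · exact Mono.prefixSum_injective (funext fun j => by rw [hp a ha, hp b hb])
      · simp [Mono.weight_eq_prefixSum, hdeg a ha, hp a ha]
  · push Not at hz
    obtain ⟨r, hr, hdr⟩ := hz
    have hle := (Finset.single_le_sum hnn (Finset.mem_range.2 (by omega : r < n / 2 + 1))).trans hW
    have h1 : d (r + 1) * (n - 2 * r) * (r + 1) ≤ 1 := by
      zify
      rw [Nat.cast_sub hr.le]
      push_cast
      exact hle
    have h2 : 0 < d (r + 1) := Nat.pos_of_ne_zero hdr
    have h3 : 0 < n - 2 * r := by omega
    have h4 : r + 1 ≤ 1 := le_trans (Nat.le_mul_of_pos_left _ (Nat.mul_pos h2 h3)) h1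
    obtain rfl : r = 0 := by omega
    simp only [zero_add, mul_one, mul_zero, Nat.sub_zero] at *
    have h5 : n ≤ 1 := le_trans (Nat.le_mul_of_pos_left _ h2) h1
    obtain rfl : n = 1 := by omega
    exact hasSymmetricChainDecomposition_Q_three hd0 (by omega)

theorem hasSymmetricChainDecomposition_Q_of_le_one {n : ℕ} (hn : n ≤ 1) (d : ℕ → ℕ) :
    HasSymmetricChainDecomposition Mono.weight (Q n d) := by
  have hmem : ∀ a : Mono n, a ∈ Q n d ↔ a.degree = d 0 := fun a =>
    (hasDegrees_of_le_one hn a).trans eq_comm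
  obtain rfl | rfl : n = 0 ∨ n = 1 := by omega
  · refine hasSymmetricChainDecomposition_of_degree_eq (m := 0) (c := d 0) fun a ha => ?_
    have h1 := (hmem a).1 ha
    have h2 : a.degree = a.coeff 0 := by simp [Mono.degree_eq_sum_range]
    refine ⟨by rw [h1]; ring, fun j => ?_⟩
    rw [a.coeff_of_lt (show 0 < j + 1 by omega)]
    rcases j with _ | j
    · omega
    · rw [a.coeff_of_lt (show 0 < j + 1 by omega)]
      omega
  · let c : ℕ → ℕ → ℕ := fun i j => if j = 0 then d 0 - i else if j = 1 then i else 0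
    let x : ℕ → Mono 1 := fun i => Mono.ofCoeff 1 (c i)
    have hx : ∀ i, (x i).coeff = c i := fun i => Mono.coeff_ofCoeff fun j hj => by
      simp only [c]
      rw [if_neg (by omega), if_neg (by omega)]
    have hdeg : ∀ a : Mono 1, a.degree = a.coeff 0 + a.coeff 1 := fun a => by
      simp [Mono.degree_eq_sum_range, Finset.sum_range_succ]
    have hxd : ∀ i ≤ d 0, (x i).degree = d 0 := fun i hi => by
      rw [hdeg, hx]
      simp [c]
      omega
    have hxw : ∀ i ≤ d 0, (x i).weight = d 0 - 2 * i := fun i hi => by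
      rw [Mono.weight_eq_sum_range, hx]
      simp [c, Finset.sum_range_succ, Nat.cast_sub hi]
      ring
    have hcov : ∀ i < d 0, x i ⋖ x (i + 1) := fun i hi => by
      refine Mono.covBy_of_le_of_weight (Mono.le_iff_prefixSum.2 ⟨?_, fun j => ?_⟩) ?_
      · rw [hxd _ hi.le, hxd _ hi]
      · by_cases hj : 1 < j
        · rw [Mono.prefixSum_of_lt _ hj, Mono.prefixSum_of_lt _ hj, hxd _ hi.le, hxd _ hi]
        · rw [Mono.prefixSum, Mono.prefixSum, hx, hx]
          interval_cases j <;> simp [c]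
          omega
      · rw [hxw _ hi.le, hxw _ hi]
        push_cast
        ring
    have key := isSymmetricSaturatedChain_of_seq (wt := Mono.weight) hcov
      (by rw [hxw _ (by omega), hxw _ le_rfl]; push_cast; ring)
    convert key.hasSymmetricChainDecomposition using 1
    ext a
    rw [hmem]
    constructor
    · intro h2
      rw [hdeg] at h2
      refine ⟨a.coeff 1, by omega, Mono.coeff_injective (funext fun j => ?_)⟩
      rw [hx]
      simp only [c]
      split_ifs with c0 c1
      · subst c0; omega
      · rw [c1]
      · exact (a.coeff_of_lt (by omega)).symm
    · rintro ⟨i, hi, rfl⟩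
      exact hxd i hi

theorem hasSymmetricChainDecomposition_Q {n : ℕ} {d : ℕ → ℕ} (hn : 2 ≤ n)
    (hQ : HasSymmetricChainDecomposition Mono.weight (Q (n - 2) fun j => d (j + 1)))
    (hW : GenericInequality n d) : HasSymmetricChainDecomposition Mono.weight (Q n d) := by
  obtain ⟨n, rfl⟩ := Nat.exists_eq_add_of_le' hn
  rw [Nat.add_sub_cancel] at hQ
  have hW' : ∑ r ∈ Finset.range (n / 2 + 1), (d (r + 1) : ℤ) * ((n : ℤ) - 2 * r) * (r + 1) ≤
      1 + 2 * d 0 := by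
    refine le_trans (le_of_eq ?_) hW
    have : Finset.Icc 1 ((n + 2) / 2) = Finset.Ico 1 (n / 2 + 2) := by
      ext j
      simp only [Finset.mem_Icc, Finset.mem_Ico]
      omega
    rw [this, Finset.sum_Ico_eq_sum_range]
    refine Finset.sum_congr rfl fun r _ => ?_
    rw [add_comm 1 r]
    push_cast
    ring
  rcases Nat.eq_zero_or_pos (d 0) with h | h
  · exact hasSymmetricChainDecomposition_Q_of_zero h (by simpa [h] using hW')
  · exact hasSymmetricChainDecomposition_Q_of_pos h hQ hW'

theorem hasSymmetricChainDecomposition_Q_of_forall : ∀ {n : ℕ} {d : ℕ → ℕ},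
    (∀ i ≤ n / 2, GenericInequality (n - 2 * i) fun j => d (j + i)) →
    HasSymmetricChainDecomposition Mono.weight (Q n d)
  | 0, d, _ => hasSymmetricChainDecomposition_Q_of_le_one (Nat.zero_le 1) d
  | 1, d, _ => hasSymmetricChainDecomposition_Q_of_le_one le_rfl d
  | n + 2, d, h => by
    refine hasSymmetricChainDecomposition_Q (by omega) ?_ (h 0 (Nat.zero_le _))
    refine hasSymmetricChainDecomposition_Q_of_forall fun i hi => ?_
    have h1 := h (i + 1) (by omega)
    have h2 : n + 2 - 2 * (i + 1) = n + 2 - 2 - 2 * i := by omega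
    rw [h2] at h1
    simpa only [add_assoc] using h1

/-! ### Transfer to `L(m,n)` -/

namespace YoungL

variable {m n : ℕ}

theorem toMono_exp (p : YoungL m n) (j : Fin (n + 1)) :
    p.toMono.exp j = ∑ i, if p i = j then 1 else 0 := by
  rw [toMono, Finsupp.finsetSum_apply]
  exact Finset.sum_congr rfl fun i _ => Finsupp.single_apply

theorem tail_toMono (p : YoungL m n) (j : ℕ) :
    p.toMono.tail j = (Finset.univ.filter fun i => j ≤ (p i : ℕ)).card := by
  rw [Mono.tail, Finset.card_filter]
  simp_rw [toMono_exp]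
  rw [Finset.sum_comm]
  refine Finset.sum_congr rfl fun i _ => ?_
  rw [Finset.sum_ite_eq]
  simp

theorem degree_toMono (p : YoungL m n) : p.toMono.degree = m := by
  rw [Mono.degree]
  simp_rw [toMono_exp]
  rw [Finset.sum_comm]
  simp

theorem weight_toMono (p : YoungL m n) : p.toMono.weight = p.weight := by
  rw [Mono.weight, weight]
  simp_rw [toMono_exp]
  push_cast
  simp_rw [Finset.sum_mul]
  rw [Finset.sum_comm]
  simp [Finset.sum_sub_distrib, Finset.mul_sum]

/-- If `p i > q i`, compare the tails at `p i`: all indices from `i` on count for `p`, but only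
indices beyond `i` for `q`. -/
theorem toMono_le_toMono {p q : YoungL m n} : p.toMono ≤ q.toMono ↔ p ≤ q := by
  constructor
  · rintro ⟨-, h⟩ i
    by_contra! hlt
    have h1 := h (p i)
    rw [tail_toMono, tail_toMono] at h1
    have h2 : Finset.Ici i ⊆ Finset.univ.filter fun k => (p i : ℕ) ≤ (p k : ℕ) := fun k hk => by
      simpa using p.monotone (Finset.mem_Ici.1 hk)
    have h3 : (Finset.univ.filter fun k => (p i : ℕ) ≤ (q k : ℕ)) ⊆ Finset.Ioi i := fun k hk => by
      rw [Finset.mem_Ioi]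
      by_contra! hki
      have h4 := q.monotone hki
      have h5 : (p i : ℕ) ≤ q k := by simpa using hk
      exact absurd (lt_of_le_of_lt h4 hlt) (not_lt.2 h5)
    have h5 := Finset.card_le_card h2
    have h6 := Finset.card_le_card h3
    rw [Fin.card_Ici] at h5
    rw [Fin.card_Ioi] at h6
    omega
  · intro h
    refine ⟨by rw [degree_toMono, degree_toMono], fun j => ?_⟩
    rw [tail_toMono, tail_toMono]
    refine Finset.card_le_card fun i hi => ?_
    simp only [Finset.mem_filter, Finset.mem_univ, true_and] at hi ⊢
    exact hi.trans (h i)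

theorem exists_toMono_eq {μ : Mono n} (h : μ.degree = m) : ∃ p : YoungL m n, p.toMono = μ := by
  obtain ⟨l, hs, hl⟩ : ∃ l : List (Fin (n + 1)), l.Pairwise (· ≤ ·) ∧
      (l : Multiset (Fin (n + 1))) = Finsupp.toMultiset μ.exp :=
    ⟨_, Multiset.pairwise_sort _ (· ≤ ·), Multiset.sort_eq _ _⟩
  have hlen : l.length = m := by
    rw [← Multiset.coe_card, hl, Finsupp.card_toMultiset, Finsupp.sum_fintype _ _ fun _ => rfl]
    exact h
  subst hlen
  refine ⟨⟨fun i => l.get i, hs.sortedLE.monotone_get⟩, ?_⟩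
  ext j
  rw [toMono_exp, ← Finsupp.count_toMultiset, ← hl, Multiset.coe_count]
  refine (Fin.sum_univ_fun_getElem l fun k => if k = j then 1 else 0).trans ?_
  clear hs hl h
  induction l with
  | nil => simp
  | cons a l ih =>
    rw [List.map_cons, List.sum_cons, ih, List.count_cons, add_comm]
    simp

/-- `L(m,n)` as a subposet of the poset of monomials. -/
noncomputable def toMonoEmbedding (m n : ℕ) : YoungL m n ↪o Mono n :=
  OrderEmbedding.ofMapLEIff toMono fun _ _ => toMono_le_toMono

end YoungL

theorem HasSymmetricChainDecomposition.preimage_toMono {m n : ℕ} {S : Set (Mono n)}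
    (h : HasSymmetricChainDecomposition Mono.weight S) (hS : ∀ μ ∈ S, μ.degree = m) :
    HasSymmetricChainDecomposition YoungL.weight (YoungL.toMono (m := m) ⁻¹' S) := by
  obtain ⟨𝒞, h1, h2, rfl⟩ := h
  refine ⟨(YoungL.toMono ⁻¹' ·) '' 𝒞, ?_, ?_, ?_⟩
  · rintro _ ⟨C, hC, rfl⟩
    obtain ⟨l, x, hx, rfl, hw⟩ := h1 C hC
    have hy : ∀ i, ∃ p : YoungL m n, p.toMono = x i := fun i =>
      YoungL.exists_toMono_eq (hS _ (Set.mem_sUnion_of_mem (Set.mem_range_self i) hC))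
    choose y hy using hy
    refine ⟨l, y, fun i => ?_, ?_, ?_⟩
    · apply CovBy.of_image (YoungL.toMonoEmbedding m n)
      change (y _).toMono ⋖ (y _).toMono
      rw [hy, hy]
      exact hx i
    · ext p
      constructor
      · rintro ⟨i, hi⟩
        exact ⟨i, (YoungL.toMonoEmbedding m n).injective ((hy i).trans hi)⟩
      · rintro ⟨i, rfl⟩
        exact ⟨i, (hy i).symm⟩
    · rw [← YoungL.weight_toMono, ← YoungL.weight_toMono, hy, hy]
      exact hw
  · rintro _ ⟨C, hC, rfl⟩ _ ⟨C', hC', rfl⟩ hne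
    exact (h2 hC hC' fun h => hne (by rw [h])).preimage _
  · ext p
    simp

theorem hasSymmetricChainDecomposition_setOf_exists_Q (m : ℕ) {n : ℕ} {P : (ℕ → ℕ) → Prop}
    (h : ∀ d, P d → HasSymmetricChainDecomposition Mono.weight (Q n d)) :
    HasSymmetricChainDecomposition YoungL.weight
      {p : YoungL m n | ∃ d, P d ∧ p.toMono ∈ Q n d} := by
  -- The index is the set rather than `d`: sequences that differ only beyond `n / 2` define the same
  -- `Q`, and the union must be disjoint.
  let ι := {T : Set (YoungL m n) // ∃ d, P d ∧ T = YoungL.toMono ⁻¹' Q n d}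
  have hun : {p : YoungL m n | ∃ d, P d ∧ p.toMono ∈ Q n d} = ⋃ T : ι, T.1 := by
    ext p
    rw [Set.mem_iUnion]
    constructor
    · rintro ⟨d, hd, hp⟩
      exact ⟨⟨_, d, hd, rfl⟩, hp⟩
    · rintro ⟨⟨_, d, hd, rfl⟩, hp⟩
      exact ⟨d, hd, hp⟩
  rw [hun]
  refine .iUnion ?_ ?_
  · rintro ⟨_, d, hd, rfl⟩
    by_cases hm : ∑ r ∈ Finset.range (n / 2 + 1), (r + 1) * d r = m
    · exact (h d hd).preimage_toMono fun μ hμ => hμ.1.degree_eq.trans hm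
    · convert hasSymmetricChainDecomposition_empty (wt := YoungL.weight) using 1
      rw [Set.eq_empty_iff_forall_notMem]
      intro p hp
      exact hm (hp.1.degree_eq.symm.trans p.degree_toMono)
  · rintro ⟨_, d, hd, rfl⟩ ⟨_, e, he, rfl⟩ hne
    rw [Set.disjoint_left]
    intro p hp hp'
    have hde := HasDegrees.unique hp hp'
    refine hne (Subtype.ext ?_)
    ext q
    exact ⟨fun hq => HasDegrees.congr hq hde,
      fun hq => HasDegrees.congr hq fun r hr => (hde r hr).symm⟩

theorem mainTheorem2 :
    (∀ (n : ℕ) (d : ℕ → ℕ), 2 ≤ n →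
      HasSymmetricChainDecomposition Mono.weight (Q (n - 2) fun j => d (j + 1)) →
      (1 + 2 * d 0 : ℤ) ≥ ∑ j ∈ Finset.Icc 1 (n / 2), (d j : ℤ) * ((n : ℤ) - 2 * j) * j →
      HasSymmetricChainDecomposition Mono.weight (Q n d)) ∧
    (∀ m n : ℕ, HasSymmetricChainDecomposition YoungL.weight (genericPart m n)) ∧
    (∀ m n : ℕ, HasSymmetricChainDecomposition YoungL.weight (hereditarilyGenericPart m n)) := by
  refine ⟨fun n d hn hQ hW => hasSymmetricChainDecomposition_Q hn hQ hW, fun m n => ?_,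
    fun m n => hasSymmetricChainDecomposition_setOf_exists_Q m fun d hd =>
      hasSymmetricChainDecomposition_Q_of_forall hd⟩
  have := hasSymmetricChainDecomposition_setOf_exists_Q m (n := n)
    (P := fun d => (2 ≤ n → HasSymmetricChainDecomposition Mono.weight
      (Q (n - 2) fun j => d (j + 1))) ∧ GenericInequality n d) fun d hd => by
        rcases le_or_gt 2 n with hn | hn
        · exact hasSymmetricChainDecomposition_Q hn (hd.1 hn) hd.2
        · exact hasSymmetricChainDecomposition_Q_of_le_one (by omega) d
  simpa only [genericPart, and_assoc] using this
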